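/- Let $\lambda>0$, let $X_1,X_2,\dots$ be i.i.d. random variables with the exponential distribution $\mathrm{Exp}(\lambda)$ (density $\lambda e^{-\lambda x}$ for $x>0$), and let $f_a(x)=x^a$ with $a>\tfrac12$. For $n\ge 1$ let $$\hat\lambda_n=\hat\lambda_{f_a,\mathrm{Exp}}=\frac{\frac1n\sum_{i=1}^n f_a'(X_i)}{\frac1n\sum_{i=1}^n f_a(X_i)}$$ be the Stein-type moment estimator of $\lambda$, and write $\binom{r}{s}=\frac{\Gamma(r+1)}{\Gamma(s+1)\,\Gamma(r-s+1)}$. Then the following hold. 1. $\hat\lambda_n$ is asymptotically normally distributed with asymptotic variance $$\sigma_n^2=\frac{\lambda^2}{n}\binom{2(a-1)}{a-1},$$ that is, $\sqrt n\,(\hat\lambda_n-\lambda)\xrightarrow{d} \mathrm N(0,\,n\sigma_n^2)$, where $n\sigma_n^2$ does not depend on $n$. 2. The asymptotic bias of $\hat\lambda_n$ is $$B_n=\frac{\lambda}{2n}\binom{2a}{a},$$ that is, for all sufficiently large $n$ the mean of $\hat\lambda_n$ exists, and $\mathbb E[\hat\lambda_n]-\lambda=B_n+o(1/n)$ as $n\to\infty$.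 3. The asymptotic mean squared error, defined as the asymptotic variance plus the squared asymptotic bias, equals $$\mathrm{MSE}_n=\sigma_n^2+B_n^2=\lambda^2\left[\frac1n\binom{2(a-1)}{a-1}+\frac1{4n^2}\binom{2a}{a}^2\right];$$ moreover, for all sufficiently large $n$ the estimator $\hat\lambda_n$ has a finite second moment, and $\mathbb E[(\hat\lambda_n-\lambda)^2]=\mathrm{MSE}_n+o(1/n)$ as $n\to\infty$. -/

import Mathlib

open MeasureTheory ProbabilityTheory Filter Topology Asymptotics
open scoped NNReal ENNReal

noncomputable section

namespace SteinMM

/-- The generalized binomial coefficient `Γ(r + 1) / Γ(s + 1) / Γ(r - s + 1)`. -/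
def genBinom (r s : ℝ) : ℝ :=
  Real.Gamma (r + 1) / Real.Gamma (s + 1) / Real.Gamma (r - s + 1)

/-- The sample moment `(1/n) ∑_{i < n} h (X i)` of the first `n` observations. -/
def sampleMoment {Ω : Type*} (h : ℝ → ℝ) (X : ℕ → Ω → ℝ) (n : ℕ) (ω : Ω) : ℝ :=
  (1 / (n : ℝ)) * ∑ i ∈ Finset.range n, h (X i ω)

/-- The Stein-type moment estimator of the rate of an exponential distribution with weight
function `f`, computed from the first `n` observations: the sample moment of `f'` divided by
the sample moment of `f`. -/
def steinEstimator {Ω : Type*} (f : ℝ → ℝ) (X : ℕ → Ω → ℝ) (n : ℕ) (ω : Ω) : ℝ :=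
  sampleMoment (deriv f) X n ω / sampleMoment f X n ω

variable {Ω : Type*} [MeasurableSpace Ω]

/-- The sequence of estimators `T n` of `θ` is asymptotically normal with asymptotic variance
`v n`: `√n (T n - θ)` converges in distribution to `N(0, σ²)`, and `v n = σ² / n`. -/
def IsAsymptoticallyNormal (T : ℕ → Ω → ℝ) (θ : ℝ) (P : Measure Ω) [IsProbabilityMeasure P]
    (v : ℕ → ℝ) : Prop :=
  ∃ σ2 : ℝ≥0,
    TendstoInDistribution (fun (n : ℕ) (ω : Ω) => Real.sqrt n * (T n ω - θ)) atTop
      (id : ℝ → ℝ) (fun _ => P) (gaussianReal 0 σ2) ∧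
    ∀ n : ℕ, 1 ≤ n → v n = (σ2 : ℝ) / n

/-- `b n` is the asymptotic bias of the estimators `T n` of `θ`: it has the form `β / n`, the
mean of `T n` exists for all large `n`, and `E[T n] - θ = b n + o(1/n)`. -/
def HasAsymptoticBias (T : ℕ → Ω → ℝ) (θ : ℝ) (P : Measure Ω) (b : ℕ → ℝ) : Prop :=
  (∃ β : ℝ, ∀ n : ℕ, 1 ≤ n → b n = β / n) ∧
  (∀ᶠ n in atTop, Integrable (T n) P) ∧
  (fun n : ℕ => ((∫ ω, T n ω ∂P) - θ) - b n) =o[atTop] (fun n : ℕ => 1 / (n : ℝ))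

/-- `m n` is the (asymptotic) mean squared error of the estimators `T n` of `θ`: the asymptotic
variance plus the square of the asymptotic bias. -/
def HasAsymptoticMSE (T : ℕ → Ω → ℝ) (θ : ℝ) (P : Measure Ω) [IsProbabilityMeasure P]
    (m : ℕ → ℝ) : Prop :=
  ∃ v b : ℕ → ℝ, IsAsymptoticallyNormal T θ P v ∧ HasAsymptoticBias T θ P b ∧
    ∀ n : ℕ, 1 ≤ n → m n = v n + b n ^ 2

end SteinMM

end

/-! For `f x = x ^ a` the error of the estimator is a ratio `∑ W i / ∑ Y i` with `W = a X ^ (a - 1)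
- lam X ^ a` and `Y = X ^ a`. By Stein's identity for the exponential law, `W` is centred. Write `μ
= E Y`, `v = E W²`, `c = E (W Y)`. Asymptotic normality with variance `v / μ²` is then the central
limit theorem for `∑ W i` combined with the strong law for `∑ Y i` (Slutsky).

Convergence in distribution says nothing about moments, so these are expanded by leaving out
observations. Let `s` be the sum of the `Y j` with `j ≠ i`, which is independent of `(W i, Y i)`. In
`E [W i / (Y i + s)]` the expansion `1/(y + s) = 1/s - y/s² + O(y²/s³)` loses its first term because
`W i` is centred, and leaves `-c E s⁻²` up to `O(n⁻³)`. There are `n` such terms and `n² E s⁻² →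
μ⁻²`, so `n` times the mean tends to `-c / μ²`. In the second moment the diagonal terms give `v /
μ²` in the same way. In a cross term, with `s` now omitting both `i` and `j`, three products of mean
zero can be subtracted. What remains is `W i * W j` times a second difference of `x⁻²`, of size
`O(n⁻⁴)`, so all cross terms together are `O(n⁻²)`.

All error bounds rest on `E (n / ∑ Y i)⁴` being bounded for large `n`. The arithmetic-geometric mean
inequality dominates this variable by `∏ X i ^ (-4a/n)`, whose mean is `Γ(1 - 4a/n) ^ n * lam ^
(4a)`; log-convexity of `Γ` bounds that uniformly in `n`. Gamma integrals then identify `v`, `c` and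
`μ` with the binomial expressions, and the squared bias, of order `n⁻²`, is absorbed in `o(1/n)`. -/

namespace SteinMM

/-- `W i` and `Y i`, adapted to independent σ-algebras `m i`, with `Y i` positive, `W i` centred,
and enough common moments, including inverse moments of the sums of the `Y i`, to expand the
moments of `(∑ W i) / (∑ Y i)`. -/
structure IsRatioSample {Ω : Type*} {mΩ : MeasurableSpace Ω} (P : Measure Ω)
    (m : ℕ → MeasurableSpace Ω) (W Y : ℕ → Ω → ℝ) (μ v c K : ℝ) (N : ℕ) : Prop where
  le : ∀ i, m i ≤ mΩ
  indep : iIndep m P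
  measurable_W : ∀ i, Measurable[m i] (W i)
  measurable_Y : ∀ i, Measurable[m i] (Y i)
  pos : ∀ i ω, 0 < Y i ω
  mean_pos : 0 < μ
  integrable_W : ∀ i, Integrable (W i) P
  integral_W : ∀ i, ∫ ω, W i ω ∂P = 0
  integrable_W_sq : ∀ i, Integrable (fun ω => W i ω ^ 2) P
  integral_W_sq : ∀ i, ∫ ω, W i ω ^ 2 ∂P = v
  memLp_Y : ∀ i, MemLp (Y i) 2 P
  integral_Y : ∀ i, ∫ ω, Y i ω ∂P = μ
  variance_Y : ∀ i, Var[Y i; P] ≤ K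
  integrable_W_mul_Y : ∀ i, Integrable (fun ω => W i ω * Y i ω) P
  integral_W_mul_Y : ∀ i, ∫ ω, W i ω * Y i ω ∂P = c
  integral_abs_W_mul_Y : ∀ i, ∫ ω, |W i ω * Y i ω| ∂P ≤ K
  integrable_W_mul_Y_sq : ∀ i, Integrable (fun ω => |W i ω| * Y i ω ^ 2) P
  integral_W_mul_Y_sq : ∀ i, ∫ ω, |W i ω| * Y i ω ^ 2 ∂P ≤ K
  integrable_W_sq_mul_Y : ∀ i, Integrable (fun ω => W i ω ^ 2 * Y i ω) P
  integral_W_sq_mul_Y : ∀ i, ∫ ω, W i ω ^ 2 * Y i ω ∂P ≤ K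
  one_le : 1 ≤ N
  -- Order four is what the second difference of `x⁻²` and the comparison of `(n / ∑ Y)²` with `μ⁻²`
  -- require. Short sums are excluded since their inverse moments may be infinite.
  integrable_inv : ∀ S : Finset ℕ, N ≤ S.card → Integrable (fun ω => (∑ i ∈ S, Y i ω)⁻¹ ^ 4) P
  integral_inv : ∀ S : Finset ℕ, N ≤ S.card →
    (S.card : ℝ) ^ 4 * ∫ ω, (∑ i ∈ S, Y i ω)⁻¹ ^ 4 ∂P ≤ K

/-! ### Independence of disjoint blocks and inverse moments of lower order. -/

section Adapted

variable {Ω : Type*} {mΩ : MeasurableSpace Ω} {P : Measure Ω} {m : ℕ → MeasurableSpace Ω}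

lemma indepFun_of_measurable_iSup (hle : ∀ i, m i ≤ mΩ) (hind : iIndep m P) {S T : Set ℕ}
    (hST : Disjoint S T) {F G : Ω → ℝ} (hF : Measurable[⨆ i ∈ S, m i] F)
    (hG : Measurable[⨆ i ∈ T, m i] G) : F ⟂ᵢ[P] G := by
  rw [IndepFun_iff_Indep]
  exact indep_of_indep_of_le_left (indep_of_indep_of_le_right
    (indep_iSup_of_disjoint hle hind hST) hG.comap_le) hF.comap_le

lemma measurable_iSup_of_mem {S : Set ℕ} {i : ℕ} (hi : i ∈ S) {F : Ω → ℝ}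
    (hF : Measurable[m i] F) : Measurable[⨆ i ∈ S, m i] F :=
  hF.mono (le_iSup₂_of_le i hi le_rfl) le_rfl

lemma measurable_iSup_sum {S : Finset ℕ} {Y : ℕ → Ω → ℝ} (hY : ∀ i, Measurable[m i] (Y i)) :
    Measurable[⨆ i ∈ (S : Set ℕ), m i] (fun ω => ∑ i ∈ S, Y i ω) :=
  Finset.measurable_fun_sum (m := ⨆ i ∈ (S : Set ℕ), m i) S
    fun i hi => measurable_iSup_of_mem (by exact_mod_cast hi) (hY i)

end Adapted

namespace IsRatioSample

variable {Ω : Type*} {mΩ : MeasurableSpace Ω} {P : Measure Ω}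
  {m : ℕ → MeasurableSpace Ω} {W Y : ℕ → Ω → ℝ} {μ v c K : ℝ} {N : ℕ}

lemma measurable_W' (h : IsRatioSample P m W Y μ v c K N) (i : ℕ) : Measurable (W i) :=
  (h.measurable_W i).mono (h.le i) le_rfl

lemma measurable_Y' (h : IsRatioSample P m W Y μ v c K N) (i : ℕ) : Measurable (Y i) :=
  (h.measurable_Y i).mono (h.le i) le_rfl

lemma measurable_sum (h : IsRatioSample P m W Y μ v c K N) (S : Finset ℕ) :
    Measurable (fun ω => ∑ i ∈ S, Y i ω) :=
  Finset.measurable_fun_sum S fun i _ => h.measurable_Y' i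

lemma measurable_ratio (h : IsRatioSample P m W Y μ v c K N) (n : ℕ) :
    Measurable fun ω => (∑ i ∈ Finset.range n, W i ω) * (∑ i ∈ Finset.range n, Y i ω)⁻¹ :=
  (Finset.measurable_fun_sum _ fun i _ => h.measurable_W' i).mul (h.measurable_sum _).inv

lemma sum_pos (h : IsRatioSample P m W Y μ v c K N) {S : Finset ℕ} (hS : N ≤ S.card) (ω : Ω) :
    0 < ∑ i ∈ S, Y i ω :=
  Finset.sum_pos (fun i _ => h.pos i ω) (Finset.card_pos.1 (h.one_le.trans hS))

lemma K_nonneg (h : IsRatioSample P m W Y μ v c K N) : 0 ≤ K :=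
  (variance_nonneg _ _).trans (h.variance_Y 0)

lemma indepFun_sum (h : IsRatioSample P m W Y μ v c K N) {S : Finset ℕ} {i : ℕ} (hi : i ∉ S)
    {F : Ω → ℝ} (hF : Measurable[m i] F) {g : ℝ → ℝ} (hg : Measurable g) :
    F ⟂ᵢ[P] fun ω => g (∑ i ∈ S, Y i ω) := by
  have hd : Disjoint ({i} : Set ℕ) (S : Set ℕ) := by simpa using hi
  have hF' := measurable_iSup_of_mem (Set.mem_singleton i) hF
  have hG := hg.comp (measurable_iSup_sum (S := S) h.measurable_Y)
  exact indepFun_of_measurable_iSup h.le h.indep hd hF' hG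

/-- Since `r ^ k ≤ 1 + r ^ 4` for `r ≥ 0` and `k ≤ 4`, control of the fourth inverse moment controls
all lower ones. -/
lemma pow_inv_le (h : IsRatioSample P m W Y μ v c K N) {S : Finset ℕ} (hS : N ≤ S.card)
    {k : ℕ} (hk : k ≤ 4) (ω : Ω) : ((S.card : ℝ) * (∑ i ∈ S, Y i ω)⁻¹) ^ k ≤
      1 + (S.card : ℝ) ^ 4 * (∑ i ∈ S, Y i ω)⁻¹ ^ 4 := by
  have hp : 0 < (S.card : ℝ) * (∑ i ∈ S, Y i ω)⁻¹ :=
    mul_pos (by exact_mod_cast h.one_le.trans hS) (inv_pos.2 (h.sum_pos hS ω))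
  rw [← mul_pow]
  rcases le_total ((S.card : ℝ) * (∑ i ∈ S, Y i ω)⁻¹) 1 with h1 | h1
  · linarith [pow_le_one₀ (n := k) hp.le h1, pow_pos hp 4]
  · linarith [pow_le_pow_right₀ h1 hk]

variable [IsProbabilityMeasure P]

lemma integrable_inv_pow (h : IsRatioSample P m W Y μ v c K N) {S : Finset ℕ} (hS : N ≤ S.card)
    {k : ℕ} (hk : k ≤ 4) : Integrable (fun ω => (∑ i ∈ S, Y i ω)⁻¹ ^ k) P := by
  have hc : (0 : ℝ) < S.card := by exact_mod_cast h.one_le.trans hS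
  have h1 : Integrable (fun ω => ((S.card : ℝ) * (∑ i ∈ S, Y i ω)⁻¹) ^ k) P := by
    refine ((integrable_const 1).add ((h.integrable_inv S hS).const_mul ((S.card : ℝ) ^ 4))).mono'
      (((h.measurable_sum S).inv.const_mul _).pow_const k).aestronglyMeasurable
      (ae_of_all _ fun ω => ?_)
    rw [Real.norm_of_nonneg (by have := h.sum_pos hS ω; positivity)]
    exact h.pow_inv_le hS hk ω
  refine (h1.const_mul (((S.card : ℝ) ^ k)⁻¹)).congr (ae_of_all _ fun ω => ?_)
  simp only [mul_pow]
  field_simp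

lemma integral_inv_pow_le (h : IsRatioSample P m W Y μ v c K N) {S : Finset ℕ}
    (hS : N ≤ S.card) {k : ℕ} (hk : k ≤ 4) :
    (S.card : ℝ) ^ k * ∫ ω, (∑ i ∈ S, Y i ω)⁻¹ ^ k ∂P ≤ 1 + K := by
  have h4 := (h.integrable_inv S hS).const_mul ((S.card : ℝ) ^ 4)
  calc _ = ∫ ω, ((S.card : ℝ) * (∑ i ∈ S, Y i ω)⁻¹) ^ k ∂P := by
        simp_rw [mul_pow, integral_const_mul]
    _ ≤ ∫ ω, (1 + (S.card : ℝ) ^ 4 * (∑ i ∈ S, Y i ω)⁻¹ ^ 4) ∂P := by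
        refine integral_mono ?_ ((integrable_const 1).add h4) fun ω => h.pow_inv_le hS hk ω
        simp_rw [mul_pow]
        exact (h.integrable_inv_pow hS hk).const_mul _
    _ = 1 + (S.card : ℝ) ^ 4 * ∫ ω, (∑ i ∈ S, Y i ω)⁻¹ ^ 4 ∂P := by
        rw [integral_add (integrable_const 1) h4, integral_const_mul]; simp
    _ ≤ 1 + K := by linarith [h.integral_inv S hS]

end IsRatioSample

/-! ### Pointwise expansions of `x⁻¹` and `x⁻²`. -/

lemma abs_inv_add_sub_le {s y : ℝ} (hs : 0 < s) (hy : 0 < y) :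
    |(y + s)⁻¹ - s⁻¹ + y * s⁻¹ ^ 2| ≤ y ^ 2 * s⁻¹ ^ 3 := by
  have h1 : (y + s)⁻¹ - s⁻¹ + y * s⁻¹ ^ 2 = y ^ 2 * (s⁻¹ ^ 2 * (y + s)⁻¹) := by
    field_simp; ring
  rw [h1, abs_of_nonneg (by positivity), pow_succ s⁻¹ 2]
  gcongr
  linarith

lemma abs_inv_sq_add_sub_le {s y : ℝ} (hs : 0 < s) (hy : 0 < y) :
    |(y + s)⁻¹ ^ 2 - s⁻¹ ^ 2| ≤ 2 * y * s⁻¹ ^ 3 := by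
  have h1 : s⁻¹ ^ 2 - (y + s)⁻¹ ^ 2 = y * s⁻¹ ^ 2 * ((y + s)⁻¹ + s * (y + s)⁻¹ * (y + s)⁻¹) := by
    field_simp; ring
  have h2 : (y + s)⁻¹ ≤ s⁻¹ := by gcongr; linarith
  have h3 : s * (y + s)⁻¹ ≤ 1 := by
    rw [← div_eq_mul_inv, div_le_one (by positivity)]; linarith
  have h4 : s * (y + s)⁻¹ * (y + s)⁻¹ ≤ 1 * s⁻¹ := by gcongr
  rw [abs_sub_comm, h1, abs_of_nonneg (by positivity)]
  calc y * s⁻¹ ^ 2 * ((y + s)⁻¹ + s * (y + s)⁻¹ * (y + s)⁻¹)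
      ≤ y * s⁻¹ ^ 2 * (s⁻¹ + 1 * s⁻¹) := by gcongr
    _ = _ := by ring

/-- The second difference of `x ↦ x⁻²`. -/
lemma abs_second_difference_inv_sq_le {s x y : ℝ} (hs : 0 < s) (hx : 0 < x) (hy : 0 < y) :
    |(y + (x + s))⁻¹ ^ 2 - (y + s)⁻¹ ^ 2 - (x + s)⁻¹ ^ 2 + s⁻¹ ^ 2| ≤ 8 * (x * y) * s⁻¹ ^ 4 := by
  set p := (x + s) * (y + s) with hp
  set q := s * (y + (x + s)) with hq
  set r := (x + s) + (y + s) with hr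
  have hpq : p = q + x * y := by rw [hp, hq]; ring
  have hp0 : 0 < p := by positivity
  have hq0 : 0 < q := by positivity
  have hr0 : 0 < r := by positivity
  have hqp : q ≤ p := by rw [hpq]; linarith [mul_pos hx hy]
  -- The pairs `(x + s, y + s)` and `(s, x + y + s)` have the same sum `r` and products `p` and `q`
  -- with `p - q = x * y`. A sum of inverse squares is `(r² - 2p) / p²`, respectively `(r² - 2q) /
  -- q²`, so their difference contains the factor `x * y`.
  have e : (y + (x + s))⁻¹ ^ 2 - (y + s)⁻¹ ^ 2 - (x + s)⁻¹ ^ 2 + s⁻¹ ^ 2 =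
      x * y / (p * q) * (r ^ 2 * (p + q) / (p * q) - 2) := by
    rw [hp, hq, hr]; field_simp; ring
  have hsp : s ^ 2 ≤ p := by
    rw [hp, sq]; exact mul_le_mul (by linarith) (by linarith) hs.le (by positivity)
  have hrq : r * s ≤ 2 * q := by
    rw [hr, hq]; nlinarith [mul_pos hs hx, mul_pos hs hy]
  have h4 : 4 * p ≤ r ^ 2 := by
    rw [hp, hr]; nlinarith [sq_nonneg (x - y)]
  have lower : 2 ≤ r ^ 2 * (p + q) / (p * q) := by
    rw [le_div_iff₀ (by positivity)]
    nlinarith [mul_pos hp0 hq0, mul_le_mul_of_nonneg_right h4 (by positivity : 0 ≤ p + q)]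
  have upper : r ^ 2 * (p + q) * s ^ 4 ≤ 8 * (p * q) * (p * q) := by
    calc r ^ 2 * (p + q) * s ^ 4 = (r * s) ^ 2 * (p + q) * s ^ 2 := by ring
      _ ≤ (2 * q) ^ 2 * (p + p) * p := by gcongr
      _ = _ := by ring
  rw [e, abs_of_nonneg (mul_nonneg (by positivity) (by linarith))]
  calc x * y / (p * q) * (r ^ 2 * (p + q) / (p * q) - 2)
      ≤ x * y / (p * q) * (r ^ 2 * (p + q) / (p * q)) := by gcongr; linarith
    _ = x * y * ((r ^ 2 * (p + q)) / ((p * q) * (p * q))) := by field_simp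
    _ ≤ x * y * (8 * s⁻¹ ^ 4) := by
        gcongr
        rw [div_le_iff₀ (by positivity), inv_pow, ← div_eq_mul_inv, div_mul_eq_mul_div,
          le_div_iff₀ (by positivity)]
        linarith
    _ = _ := by ring

/-! ### Leave-one-out and leave-two-out estimates. -/

namespace IsRatioSample

variable {Ω : Type*} {mΩ : MeasurableSpace Ω} {P : Measure Ω}
  {m : ℕ → MeasurableSpace Ω} {W Y : ℕ → Ω → ℝ} {μ v c K : ℝ} {N : ℕ}

lemma integral_mul_of_notMem (h : IsRatioSample P m W Y μ v c K N) {S : Finset ℕ} {i : ℕ}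
    (hi : i ∉ S) {F G : Ω → ℝ} (hF : Measurable[m i] F)
    (hG : Measurable[⨆ k ∈ (S : Set ℕ), m k] G) (hFi : Integrable F P) (hGi : Integrable G P) :
    Integrable (fun ω => F ω * G ω) P ∧
      ∫ ω, F ω * G ω ∂P = (∫ ω, F ω ∂P) * ∫ ω, G ω ∂P := by
  have hd : Disjoint ({i} : Set ℕ) (S : Set ℕ) := by simpa using hi
  have hind : F ⟂ᵢ[P] G := indepFun_of_measurable_iSup h.le h.indep hd
    (measurable_iSup_of_mem (Set.mem_singleton i) hF) hG
  exact ⟨hind.integrable_mul hFi hGi,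
    hind.integral_mul_eq_mul_integral hFi.aestronglyMeasurable hGi.aestronglyMeasurable⟩

/-- Independence of `W i` from the block `S` and centring make the products subtracted from the
cross terms vanish in mean. -/
lemma integral_W_mul_eq_zero (h : IsRatioSample P m W Y μ v c K N) {S : Finset ℕ} {i : ℕ}
    (hi : i ∉ S) {G : Ω → ℝ} (hG : Measurable[⨆ k ∈ (S : Set ℕ), m k] G)
    (hGi : Integrable G P) :
    Integrable (fun ω => W i ω * G ω) P ∧ ∫ ω, W i ω * G ω ∂P = 0 := by
  obtain ⟨h1, h2⟩ := h.integral_mul_of_notMem hi (h.measurable_W i) hG (h.integrable_W i) hGi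
  exact ⟨h1, by rw [h2, h.integral_W, zero_mul]⟩

lemma measurable_iSup_W_mul_inv_sq (h : IsRatioSample P m W Y μ v c K N) {S : Finset ℕ} {i : ℕ}
    {T : Finset ℕ} (hi : i ∈ S) (hTS : T ⊆ S) : Measurable[⨆ k ∈ (S : Set ℕ), m k]
      (fun ω => W i ω * (∑ j ∈ T, Y j ω)⁻¹ ^ 2) :=
  (measurable_iSup_of_mem (by exact_mod_cast hi) (h.measurable_W i)).mul
    (((measurable_iSup_sum h.measurable_Y).mono
      (biSup_mono fun k hk => by exact_mod_cast hTS hk) le_rfl).inv.pow_const 2)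

variable [IsProbabilityMeasure P]

lemma integral_mul_inv_pow (h : IsRatioSample P m W Y μ v c K N) {S : Finset ℕ}
    (hS : N ≤ S.card) {i : ℕ} (hi : i ∉ S) {k : ℕ} (hk : k ≤ 4) {F : Ω → ℝ}
    (hF : Measurable[m i] F) (hFi : Integrable F P) :
    Integrable (fun ω => F ω * (∑ j ∈ S, Y j ω)⁻¹ ^ k) P ∧
      ∫ ω, F ω * (∑ j ∈ S, Y j ω)⁻¹ ^ k ∂P =
        (∫ ω, F ω ∂P) * ∫ ω, (∑ j ∈ S, Y j ω)⁻¹ ^ k ∂P :=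
  h.integral_mul_of_notMem hi hF ((measurable_iSup_sum h.measurable_Y).inv.pow_const k) hFi
    (h.integrable_inv_pow hS hk)

lemma card_pow_mul_integral_le (h : IsRatioSample P m W Y μ v c K N) {S : Finset ℕ}
    (hS : N ≤ S.card) {i : ℕ} (hi : i ∉ S) {k : ℕ} (hk : k ≤ 4) {F : Ω → ℝ}
    (hF : Measurable[m i] F) (hFi : Integrable F P) (hK : ∫ ω, F ω ∂P ≤ K) :
    (S.card : ℝ) ^ k * ∫ ω, F ω * (∑ j ∈ S, Y j ω)⁻¹ ^ k ∂P ≤ K * (1 + K) := by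
  rw [(h.integral_mul_inv_pow hS hi hk hF hFi).2, mul_left_comm]
  refine mul_le_mul hK (h.integral_inv_pow_le hS hk) ?_ h.K_nonneg
  have : 0 ≤ ∫ ω, (∑ j ∈ S, Y j ω)⁻¹ ^ k ∂P :=
    integral_nonneg fun ω => pow_nonneg (inv_nonneg.2 (h.sum_pos hS ω).le) k
  positivity

/-- Restoring `Y i > 0` only lowers the inverse, so the leave-one-out product, whose factors are
independent, dominates. -/
lemma integrable_W_mul_inv (h : IsRatioSample P m W Y μ v c K N) {S : Finset ℕ}
    (hS : N ≤ S.card) {i : ℕ} (hi : i ∉ S) :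
    Integrable (fun ω => W i ω * (∑ j ∈ insert i S, Y j ω)⁻¹) P := by
  refine (h.integral_mul_inv_pow hS hi (k := 1) (by norm_num) (h.measurable_W i)
    (h.integrable_W i)).1.mono
    ((h.measurable_W' i).mul (h.measurable_sum _).inv).aestronglyMeasurable
    (ae_of_all _ fun ω => ?_)
  have hs := h.sum_pos hS ω
  have hy := h.pos i ω
  rw [Finset.sum_insert hi, norm_mul, norm_mul, pow_one,
    Real.norm_of_nonneg (r := (Y i ω + ∑ j ∈ S, Y j ω)⁻¹) (by positivity),
    Real.norm_of_nonneg (r := (∑ j ∈ S, Y j ω)⁻¹) (by positivity)]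
  gcongr
  linarith

lemma integrable_W_sq_mul_inv_sq (h : IsRatioSample P m W Y μ v c K N) {S : Finset ℕ}
    (hS : N ≤ S.card) {i : ℕ} (hi : i ∉ S) :
    Integrable (fun ω => W i ω ^ 2 * (∑ j ∈ insert i S, Y j ω)⁻¹ ^ 2) P := by
  refine (h.integral_mul_inv_pow hS hi (k := 2) (by norm_num) ((h.measurable_W i).pow_const 2)
    (h.integrable_W_sq i)).1.mono
    (((h.measurable_W' i).pow_const 2).mul
      ((h.measurable_sum _).inv.pow_const 2)).aestronglyMeasurable
    (ae_of_all _ fun ω => ?_)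
  have hs := h.sum_pos hS ω
  have hy := h.pos i ω
  rw [Finset.sum_insert hi, Real.norm_of_nonneg (by positivity),
    Real.norm_of_nonneg (by positivity)]
  gcongr
  linarith

/-- First-order Taylor expansion of `(y + s)⁻¹` at `s`: the zeroth-order term has mean zero, the
linear one factorizes by independence, and the remainder is at most `|W| * Y² * s⁻³`. -/
lemma abs_integral_W_mul_inv_add_le (h : IsRatioSample P m W Y μ v c K N) {S : Finset ℕ}
    (hS : N ≤ S.card) {i : ℕ} (hi : i ∉ S) :
    (S.card : ℝ) ^ 3 * |(∫ ω, W i ω * (∑ j ∈ insert i S, Y j ω)⁻¹ ∂P) +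
      c * ∫ ω, (∑ j ∈ S, Y j ω)⁻¹ ^ 2 ∂P| ≤ K * (1 + K) := by
  have i0 := h.integrable_W_mul_inv hS hi
  obtain ⟨i1, e1⟩ := h.integral_mul_inv_pow hS hi (k := 1) (by norm_num) (h.measurable_W i)
    (h.integrable_W i)
  obtain ⟨i2, e2⟩ := h.integral_mul_inv_pow hS hi (k := 2) (by norm_num)
    ((h.measurable_W i).mul (h.measurable_Y i)) (h.integrable_W_mul_Y i)
  have mF : Measurable[m i] fun ω => |W i ω| * Y i ω ^ 2 :=
    (continuous_abs.measurable.comp (h.measurable_W i)).mul ((h.measurable_Y i).pow_const 2)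
  obtain ⟨i3, -⟩ := h.integral_mul_inv_pow hS hi (k := 3) (by norm_num) mF
    (h.integrable_W_mul_Y_sq i)
  refine le_trans ?_ (h.card_pow_mul_integral_le hS hi (k := 3) (by norm_num) mF
    (h.integrable_W_mul_Y_sq i) (h.integral_W_mul_Y_sq i))
  gcongr
  simp only [Pi.mul_apply] at i2 e2
  rw [← h.integral_W_mul_Y i, ← e2]
  have : ∫ ω, W i ω * (∑ j ∈ insert i S, Y j ω)⁻¹ ∂P =
      ∫ ω, (W i ω * (∑ j ∈ insert i S, Y j ω)⁻¹ - W i ω * (∑ j ∈ S, Y j ω)⁻¹ ^ 1) ∂P := by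
    rw [integral_sub i0 i1, e1, h.integral_W]; simp
  have i01 : Integrable (fun ω => W i ω * (∑ j ∈ insert i S, Y j ω)⁻¹ -
      W i ω * (∑ j ∈ S, Y j ω)⁻¹ ^ 1) P := i0.sub i1
  rw [this, ← integral_add i01 i2]
  refine abs_integral_le_integral_abs.trans
    (integral_mono (i01.add i2).abs i3 fun ω => ?_)
  have hs := h.sum_pos hS ω
  have hy := h.pos i ω
  have := abs_inv_add_sub_le hs hy
  calc _ = |W i ω| * |(Y i ω + ∑ j ∈ S, Y j ω)⁻¹ - (∑ j ∈ S, Y j ω)⁻¹ +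
        Y i ω * (∑ j ∈ S, Y j ω)⁻¹ ^ 2| := by
        rw [← abs_mul, Finset.sum_insert hi]; congr 1; ring
    _ ≤ |W i ω| * (Y i ω ^ 2 * (∑ j ∈ S, Y j ω)⁻¹ ^ 3) := by gcongr
    _ = _ := by ring

lemma abs_integral_W_sq_mul_inv_sq_sub_le (h : IsRatioSample P m W Y μ v c K N) {S : Finset ℕ}
    (hS : N ≤ S.card) {i : ℕ} (hi : i ∉ S) :
    (S.card : ℝ) ^ 3 * |(∫ ω, W i ω ^ 2 * (∑ j ∈ insert i S, Y j ω)⁻¹ ^ 2 ∂P) -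
      v * ∫ ω, (∑ j ∈ S, Y j ω)⁻¹ ^ 2 ∂P| ≤ 2 * (K * (1 + K)) := by
  have i0 := h.integrable_W_sq_mul_inv_sq hS hi
  obtain ⟨i1, e1⟩ := h.integral_mul_inv_pow hS hi (k := 2) (by norm_num)
    ((h.measurable_W i).pow_const 2) (h.integrable_W_sq i)
  have mF : Measurable[m i] fun ω => W i ω ^ 2 * Y i ω :=
    ((h.measurable_W i).pow_const 2).mul (h.measurable_Y i)
  obtain ⟨i3, -⟩ := h.integral_mul_inv_pow hS hi (k := 3) (by norm_num) mF
    (h.integrable_W_sq_mul_Y i)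
  refine le_trans ?_ (mul_le_mul_of_nonneg_left (h.card_pow_mul_integral_le hS hi (k := 3)
    (by norm_num) mF (h.integrable_W_sq_mul_Y i) (h.integral_W_sq_mul_Y i)) zero_le_two)
  rw [mul_left_comm, ← integral_const_mul (2 : ℝ)]
  gcongr
  rw [← h.integral_W_sq i, ← e1, ← integral_sub i0 i1]
  refine abs_integral_le_integral_abs.trans
    (integral_mono (i0.sub i1).abs (i3.const_mul 2) fun ω => ?_)
  have hs := h.sum_pos hS ω
  have hy := h.pos i ω
  have := abs_inv_sq_add_sub_le hs hy
  calc _ = W i ω ^ 2 * |(Y i ω + ∑ j ∈ S, Y j ω)⁻¹ ^ 2 - (∑ j ∈ S, Y j ω)⁻¹ ^ 2| := by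
        rw [← abs_of_nonneg (sq_nonneg (W i ω)), ← abs_mul, Finset.sum_insert hi,
          abs_of_nonneg (sq_nonneg (W i ω))]; congr 1; ring
    _ ≤ W i ω ^ 2 * (2 * Y i ω * (∑ j ∈ S, Y j ω)⁻¹ ^ 3) := by gcongr
    _ = _ := by ring

lemma integrable_W_mul_inv_sq (h : IsRatioSample P m W Y μ v c K N) {S : Finset ℕ}
    (hS : N ≤ S.card) {i : ℕ} (hi : i ∉ S) :
    Integrable (fun ω => W i ω * (∑ j ∈ insert i S, Y j ω)⁻¹ ^ 2) P := by
  refine (h.integral_mul_inv_pow hS hi (k := 2) (by norm_num) (h.measurable_W i)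
    (h.integrable_W i)).1.mono
    ((h.measurable_W' i).mul ((h.measurable_sum _).inv.pow_const 2)).aestronglyMeasurable
    (ae_of_all _ fun ω => ?_)
  have hs := h.sum_pos hS ω
  have hy := h.pos i ω
  rw [Finset.sum_insert hi, norm_mul, norm_mul,
    Real.norm_of_nonneg (r := (Y i ω + ∑ j ∈ S, Y j ω)⁻¹ ^ 2) (by positivity),
    Real.norm_of_nonneg (r := (∑ j ∈ S, Y j ω)⁻¹ ^ 2) (by positivity)]
  gcongr
  linarith

/-- Dropping `Y i`, `Y j` or both from the denominator leaves some centred factor independent of the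
rest. These three products can be combined freely with the cross term to form a second difference,
which gains two powers of the sum. -/
lemma abs_integral_W_mul_W_mul_inv_sq_le (h : IsRatioSample P m W Y μ v c K N) {S : Finset ℕ}
    (hS : N ≤ S.card) {i j : ℕ} (hi : i ∉ S) (hj : j ∉ S) (hij : i ≠ j) :
    Integrable (fun ω => W j ω * (W i ω * (∑ k ∈ insert j (insert i S), Y k ω)⁻¹ ^ 2)) P ∧
    (S.card : ℝ) ^ 4 *
      |∫ ω, W j ω * (W i ω * (∑ k ∈ insert j (insert i S), Y k ω)⁻¹ ^ 2) ∂P| ≤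
        8 * (K * (K * (1 + K))) := by
  have hjS : j ∉ insert i S := by simp [hj, hij.symm]
  have hiS : i ∉ insert j S := by simp [hi, hij]
  obtain ⟨i1, e1⟩ := h.integral_W_mul_eq_zero hjS
    (h.measurable_iSup_W_mul_inv_sq (Finset.mem_insert_self i S) (Finset.Subset.refl _))
    (h.integrable_W_mul_inv_sq hS hi)
  obtain ⟨i2, e2⟩ := h.integral_W_mul_eq_zero hiS
    (h.measurable_iSup_W_mul_inv_sq (Finset.mem_insert_self j S) (Finset.Subset.refl _))
    (h.integrable_W_mul_inv_sq hS hj)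
  obtain ⟨i3, e3⟩ := h.integral_W_mul_eq_zero hjS
    (h.measurable_iSup_W_mul_inv_sq (Finset.mem_insert_self i S) (Finset.subset_insert i S))
    (h.integral_mul_inv_pow hS hi (k := 2) (by norm_num) (h.measurable_W i)
      (h.integrable_W i)).1
  have mF (l : ℕ) : Measurable[m l] fun ω => |W l ω * Y l ω| :=
    continuous_abs.measurable.comp ((h.measurable_W l).mul (h.measurable_Y l))
  have mG : Measurable[⨆ k ∈ ((insert i S : Finset ℕ) : Set ℕ), m k]
      fun ω => |W i ω * Y i ω| * (∑ k ∈ S, Y k ω)⁻¹ ^ 4 :=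
    (measurable_iSup_of_mem (by simp) (mF i)).mul
      (((measurable_iSup_sum h.measurable_Y).mono
        (biSup_mono fun k hk => by
          exact_mod_cast Finset.mem_insert_of_mem (by exact_mod_cast hk)) le_rfl).inv.pow_const 4)
  obtain ⟨i4, e4⟩ := h.integral_mul_of_notMem hjS (mF j) mG (h.integrable_W_mul_Y j).abs
    (h.integral_mul_inv_pow hS hi le_rfl (mF i) (h.integrable_W_mul_Y i).abs).1
  have key (ω : Ω) : |W j ω * (W i ω * (∑ k ∈ insert j (insert i S), Y k ω)⁻¹ ^ 2) -
      W j ω * (W i ω * (∑ k ∈ insert i S, Y k ω)⁻¹ ^ 2) -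
      W i ω * (W j ω * (∑ k ∈ insert j S, Y k ω)⁻¹ ^ 2) +
      W j ω * (W i ω * (∑ k ∈ S, Y k ω)⁻¹ ^ 2)| ≤
      8 * (|W j ω * Y j ω| * (|W i ω * Y i ω| * (∑ k ∈ S, Y k ω)⁻¹ ^ 4)) := by
    have hs := h.sum_pos hS ω
    have hx := h.pos i ω
    have hy := h.pos j ω
    have := abs_second_difference_inv_sq_le hs hx hy
    rw [Finset.sum_insert hjS, Finset.sum_insert hi, Finset.sum_insert hj, abs_mul, abs_mul,
      abs_of_pos hx, abs_of_pos hy]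
    calc _ = |W j ω * W i ω| * |(Y j ω + (Y i ω + ∑ k ∈ S, Y k ω))⁻¹ ^ 2 -
          (Y j ω + ∑ k ∈ S, Y k ω)⁻¹ ^ 2 - (Y i ω + ∑ k ∈ S, Y k ω)⁻¹ ^ 2 +
          (∑ k ∈ S, Y k ω)⁻¹ ^ 2| := by rw [← abs_mul]; congr 1; ring
      _ ≤ |W j ω * W i ω| * (8 * (Y i ω * Y j ω) * (∑ k ∈ S, Y k ω)⁻¹ ^ 4) := by gcongr
      _ = _ := by rw [abs_mul]; ring
  have iD : Integrable (fun ω => W j ω * (W i ω * (∑ k ∈ insert j (insert i S), Y k ω)⁻¹ ^ 2) -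
      W j ω * (W i ω * (∑ k ∈ insert i S, Y k ω)⁻¹ ^ 2) -
      W i ω * (W j ω * (∑ k ∈ insert j S, Y k ω)⁻¹ ^ 2) +
      W j ω * (W i ω * (∑ k ∈ S, Y k ω)⁻¹ ^ 2)) P := by
    have mW := h.measurable_W'
    have mS := h.measurable_sum
    refine (i4.const_mul 8).mono' (Measurable.aestronglyMeasurable ?_) (ae_of_all _ key)
    have := mS S; have := mS (insert i S); have := mS (insert j S)
    have := mS (insert j (insert i S))
    fun_prop
  -- Integrability passes from the dominated second difference to the cross term, the other three
  -- products being integrable.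
  have i0 : Integrable
      (fun ω => W j ω * (W i ω * (∑ k ∈ insert j (insert i S), Y k ω)⁻¹ ^ 2)) P :=
    (((iD.sub i3).add i2).add i1).congr (ae_of_all _ fun ω => by
      simp only [Pi.add_apply, Pi.sub_apply]; ring)
  refine ⟨i0, ?_⟩
  have e0 : ∫ ω, W j ω * (W i ω * (∑ k ∈ insert j (insert i S), Y k ω)⁻¹ ^ 2) ∂P =
      ∫ ω, (W j ω * (W i ω * (∑ k ∈ insert j (insert i S), Y k ω)⁻¹ ^ 2) -
      W j ω * (W i ω * (∑ k ∈ insert i S, Y k ω)⁻¹ ^ 2) -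
      W i ω * (W j ω * (∑ k ∈ insert j S, Y k ω)⁻¹ ^ 2) +
      W j ω * (W i ω * (∑ k ∈ S, Y k ω)⁻¹ ^ 2)) ∂P := by
    rw [integral_add (by exact (i0.sub i1).sub i2) i3, integral_sub (by exact i0.sub i1) i2, integral_sub i0 i1,
      e1, e2, e3]
    ring
  rw [e0]
  have hb := h.card_pow_mul_integral_le hS hi (k := 4) le_rfl (mF i) (h.integrable_W_mul_Y i).abs
    (h.integral_abs_W_mul_Y i)
  have h0 : 0 ≤ (S.card : ℝ) ^ 4 * ∫ ω, |W i ω * Y i ω| * (∑ k ∈ S, Y k ω)⁻¹ ^ 4 ∂P :=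
    mul_nonneg (by positivity) (integral_nonneg fun ω => by positivity)
  calc _ ≤ (S.card : ℝ) ^ 4 *
        ∫ ω, 8 * (|W j ω * Y j ω| * (|W i ω * Y i ω| * (∑ k ∈ S, Y k ω)⁻¹ ^ 4)) ∂P := by
        gcongr
        exact abs_integral_le_integral_abs.trans
          (integral_mono iD.abs (i4.const_mul 8) fun ω => key ω)
    _ = 8 * ((∫ ω, |W j ω * Y j ω| ∂P) *
        ((S.card : ℝ) ^ 4 * ∫ ω, |W i ω * Y i ω| * (∑ k ∈ S, Y k ω)⁻¹ ^ 4 ∂P)) := by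
        rw [integral_const_mul, e4]; ring
    _ ≤ _ := by
        gcongr
        · exact h.K_nonneg
        · exact h.integral_abs_W_mul_Y j

end IsRatioSample

/-! ### Convergence of inverse moments and passage to the limit. -/

lemma tendsto_natCast_sub_atTop (k : ℝ) : Tendsto (fun n : ℕ => (n : ℝ) - k) atTop atTop := by
  simpa [sub_eq_add_neg] using
    tendsto_atTop_add_const_right atTop (-k) (tendsto_natCast_atTop_atTop (R := ℝ))

/-- Each of the `n` summands is uniformly close to `L / (n - 1)²`; the normalization `n - 1` is the
size of a leave-one-out sample. -/
lemma tendsto_mul_sum_of_uniform {a : ℕ → ℕ → ℝ} {ε : ℕ → ℝ} {L : ℝ}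
    (hε : Tendsto ε atTop (𝓝 0))
    (ha : ∀ᶠ n : ℕ in atTop, ∀ i < n, |((n : ℝ) - 1) ^ 2 * a n i - L| ≤ ε n) :
    Tendsto (fun n : ℕ => (n : ℝ) * ∑ i ∈ Finset.range n, a n i) atTop (𝓝 L) := by
  have hr : Tendsto (fun n : ℕ => ((n : ℝ) / ((n : ℝ) - 1)) ^ 2) atTop (𝓝 1) := by
    have h1 : Tendsto (fun n : ℕ => 1 + ((n : ℝ) - 1)⁻¹) atTop (𝓝 (1 + 0)) :=
      tendsto_const_nhds.add (tendsto_natCast_sub_atTop 1).inv_tendsto_atTop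
    have h2 := h1.pow 2
    simp only [add_zero, one_pow] at h2
    refine h2.congr' ?_
    filter_upwards [eventually_ge_atTop 2] with n hn
    have : (2 : ℝ) ≤ n := by exact_mod_cast hn
    have : (n : ℝ) - 1 ≠ 0 := by linarith
    congr 1
    field_simp
    ring
  have hd : Tendsto (fun n : ℕ => (n : ℝ) * ∑ i ∈ Finset.range n, a n i -
      ((n : ℝ) / ((n : ℝ) - 1)) ^ 2 * L) atTop (𝓝 0) := by
    refine squeeze_zero_norm' (a := fun n : ℕ => ((n : ℝ) / ((n : ℝ) - 1)) ^ 2 * ε n) ?_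
      (by simpa using hr.mul hε)
    filter_upwards [ha, eventually_ge_atTop 2] with n hn h2
    have h2' : (2 : ℝ) ≤ n := by exact_mod_cast h2
    have hn1 : (0 : ℝ) < n - 1 := by linarith
    have e : (n : ℝ) * ∑ i ∈ Finset.range n, a n i - ((n : ℝ) / ((n : ℝ) - 1)) ^ 2 * L =
        ∑ i ∈ Finset.range n, n / ((n : ℝ) - 1) ^ 2 * (((n : ℝ) - 1) ^ 2 * a n i - L) := by
      rw [← Finset.mul_sum, Finset.sum_sub_distrib, ← Finset.mul_sum]
      simp only [Finset.sum_const, Finset.card_range, nsmul_eq_mul]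
      field_simp
    rw [e, Real.norm_eq_abs]
    calc _ ≤ ∑ i ∈ Finset.range n, |n / ((n : ℝ) - 1) ^ 2 * (((n : ℝ) - 1) ^ 2 * a n i - L)| :=
          Finset.abs_sum_le_sum_abs _ _
      _ ≤ ∑ i ∈ Finset.range n, n / ((n : ℝ) - 1) ^ 2 * ε n := by
          refine Finset.sum_le_sum fun i hi => ?_
          rw [abs_mul, abs_of_nonneg (by positivity)]
          exact mul_le_mul_of_nonneg_left (hn i (Finset.mem_range.1 hi)) (by positivity)
      _ = _ := by
          simp only [Finset.sum_const, Finset.card_range, nsmul_eq_mul]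
          field_simp
  simpa using hd.add (hr.mul_const L)

/-- For `r = n / ∑ Y`, the inverse `r⁻¹` is the sample mean, whose variance is explicit. Factoring
out `r⁻¹ - μ` and applying `2|xy| ≤ t x² + y²/t` leaves that variance and powers of `r` up to the
fourth. -/
lemma abs_sq_sub_inv_sq_le {r μ t : ℝ} (hr : 0 < r) (hμ : 0 < μ) (ht : 0 < t) :
    |r ^ 2 - (μ ^ 2)⁻¹| ≤
      (t * (r⁻¹ - μ) ^ 2 + (2 * (μ ^ 2)⁻¹ * r ^ 4 + 2 * (μ ^ 4)⁻¹ * r ^ 2) / t) / 2 := by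
  have e : r ^ 2 - (μ ^ 2)⁻¹ = -((r⁻¹ - μ) * (r * μ⁻¹ * (r + μ⁻¹))) := by
    field_simp; ring
  have e2 : (r * μ⁻¹ * (r + μ⁻¹)) ^ 2 ≤ 2 * (μ ^ 2)⁻¹ * r ^ 4 + 2 * (μ ^ 4)⁻¹ * r ^ 2 := by
    have : 2 * (μ ^ 2)⁻¹ * r ^ 4 + 2 * (μ ^ 4)⁻¹ * r ^ 2 - (r * μ⁻¹ * (r + μ⁻¹)) ^ 2 =
        (r * μ⁻¹ * (r - μ⁻¹)) ^ 2 := by field_simp; ring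
    linarith [sq_nonneg (r * μ⁻¹ * (r - μ⁻¹))]
  have e3 : (r * μ⁻¹ * (r + μ⁻¹)) ^ 2 / t ≤
      (2 * (μ ^ 2)⁻¹ * r ^ 4 + 2 * (μ ^ 4)⁻¹ * r ^ 2) / t := by gcongr
  rw [e, abs_neg]
  set x := r⁻¹ - μ
  set y := r * μ⁻¹ * (r + μ⁻¹)
  have e4 : |x * y| ≤ (t * x ^ 2 + y ^ 2 / t) / 2 := by
    rw [abs_le]
    have h1 : 0 ≤ (t * x + y) ^ 2 / t := by positivity
    have h2 : 0 ≤ (t * x - y) ^ 2 / t := by positivity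
    have h1' : (t * x + y) ^ 2 / t = t * x ^ 2 + 2 * (x * y) + y ^ 2 / t := by field_simp; ring
    have h2' : (t * x - y) ^ 2 / t = t * x ^ 2 - 2 * (x * y) + y ^ 2 / t := by field_simp; ring
    constructor <;> linarith
  linarith

namespace IsRatioSample

variable {Ω : Type*} {mΩ : MeasurableSpace Ω} {P : Measure Ω} [IsProbabilityMeasure P]
  {m : ℕ → MeasurableSpace Ω} {W Y : ℕ → Ω → ℝ} {μ v c K : ℝ} {N : ℕ}

lemma integral_mean_sub_sq (h : IsRatioSample P m W Y μ v c K N) {S : Finset ℕ}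
    (hS : N ≤ S.card) :
    Integrable (fun ω => (((S.card : ℝ) * (∑ i ∈ S, Y i ω)⁻¹)⁻¹ - μ) ^ 2) P ∧
      S.card * ∫ ω, (((S.card : ℝ) * (∑ i ∈ S, Y i ω)⁻¹)⁻¹ - μ) ^ 2 ∂P ≤ K := by
  have hc : (0 : ℝ) < S.card := by exact_mod_cast h.one_le.trans hS
  have hL : MemLp (fun ω => ∑ i ∈ S, Y i ω) 2 P := memLp_finsetSum S fun i _ => h.memLp_Y i
  have hm : ∫ ω, ∑ i ∈ S, Y i ω ∂P = S.card * μ := by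
    rw [integral_finsetSum _ fun i _ => (h.memLp_Y i).integrable (by norm_num)]
    simp [h.integral_Y]
  have hvar : Var[fun ω => ∑ i ∈ S, Y i ω; P] ≤ S.card * K := by
    have : (fun ω => ∑ i ∈ S, Y i ω) = ∑ i ∈ S, Y i := by ext; simp
    rw [this, IndepFun.variance_sum (fun i _ => h.memLp_Y i)]
    · simpa using Finset.sum_le_sum fun i (_ : i ∈ S) => h.variance_Y i
    · intro i _ j _ hij
      have := h.indepFun_sum (S := {j}) (by simpa using hij) (h.measurable_Y i) measurable_id
      simpa using this
  rw [variance_eq_integral (h.measurable_sum S).aemeasurable, hm] at hvar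
  have e : (fun ω => (((S.card : ℝ) * (∑ i ∈ S, Y i ω)⁻¹)⁻¹ - μ) ^ 2) =
      fun ω => ((S.card : ℝ) ^ 2)⁻¹ * (∑ i ∈ S, Y i ω - S.card * μ) ^ 2 := by
    ext ω
    have := h.sum_pos hS ω
    field_simp
  rw [e, integral_const_mul]
  refine ⟨((hL.sub (memLp_const _)).integrable_sq).const_mul _, ?_⟩
  calc _ ≤ (S.card : ℝ) * (((S.card : ℝ) ^ 2)⁻¹ * (S.card * K)) := by gcongr
    _ = K := by field_simp

lemma exists_abs_integral_inv_sq_sub_le (h : IsRatioSample P m W Y μ v c K N) :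
    ∃ C : ℝ, ∀ S : Finset ℕ, N ≤ S.card →
      |(S.card : ℝ) ^ 2 * (∫ ω, (∑ i ∈ S, Y i ω)⁻¹ ^ 2 ∂P) - (μ ^ 2)⁻¹| ≤
        C / √(S.card) := by
  refine ⟨(K + (2 * (μ ^ 2)⁻¹ * (1 + K) + 2 * (μ ^ 4)⁻¹ * (1 + K))) / 2, fun S hS => ?_⟩
  have hμ := h.mean_pos
  have hc : (0 : ℝ) < S.card := by exact_mod_cast h.one_le.trans hS
  -- The weight `t = √card` balances `t * K / card` against `O(1) / t`: both are of order `1 /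
  -- √card`.
  have ht : 0 < √(S.card : ℝ) := Real.sqrt_pos.2 hc
  obtain ⟨i0, b0⟩ := h.integral_mean_sub_sq hS
  have i2 := (h.integrable_inv_pow hS (k := 2) (by norm_num)).const_mul ((S.card : ℝ) ^ 2)
  have i4 := (h.integrable_inv_pow hS (k := 4) le_rfl).const_mul ((S.card : ℝ) ^ 4)
  have b2 := h.integral_inv_pow_le hS (k := 2) (by norm_num)
  have b4 := h.integral_inv_pow_le hS (k := 4) le_rfl
  rw [← integral_const_mul] at b2 b4 ⊢
  simp only [← mul_pow] at i2 i4 b2 b4 ⊢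
  have key (ω : Ω) := abs_sq_sub_inv_sq_le
    (mul_pos hc (inv_pos.2 (h.sum_pos hS ω))) hμ ht
  have iq := (i4.const_mul (2 * (μ ^ 2)⁻¹)).add (i2.const_mul (2 * (μ ^ 4)⁻¹))
  have e : (∫ ω, ((S.card : ℝ) * (∑ i ∈ S, Y i ω)⁻¹) ^ 2 ∂P) - (μ ^ 2)⁻¹ =
      ∫ ω, (((S.card : ℝ) * (∑ i ∈ S, Y i ω)⁻¹) ^ 2 - (μ ^ 2)⁻¹) ∂P := by
    rw [integral_sub i2 (integrable_const _)]; simp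
  rw [e]
  refine abs_integral_le_integral_abs.trans ((integral_mono (i2.sub (integrable_const _)).abs
    (((i0.const_mul (√(S.card : ℝ))).add (iq.div_const (√(S.card : ℝ)))).div_const 2)
    fun ω => key ω).trans ?_)
  simp only [Pi.add_apply]
  rw [integral_div, integral_add (i0.const_mul _) (by exact iq.div_const _), integral_const_mul,
    integral_div, integral_add (i4.const_mul _) (i2.const_mul _), integral_const_mul,
    integral_const_mul]
  have b0' : √(S.card : ℝ) * ∫ ω, (((S.card : ℝ) * (∑ i ∈ S, Y i ω)⁻¹)⁻¹ - μ) ^ 2 ∂P ≤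
      K / √(S.card : ℝ) := by
    rw [le_div_iff₀ ht]
    calc _ = (√(S.card : ℝ) * √(S.card : ℝ)) *
          ∫ ω, (((S.card : ℝ) * (∑ i ∈ S, Y i ω)⁻¹)⁻¹ - μ) ^ 2 ∂P := by ring
      _ ≤ K := by rw [Real.mul_self_sqrt hc.le]; exact b0
  calc _ ≤ (K / √(S.card : ℝ) +
        (2 * (μ ^ 2)⁻¹ * (1 + K) + 2 * (μ ^ 4)⁻¹ * (1 + K)) / √(S.card : ℝ)) / 2 := by
        gcongr
    _ = _ := by ring

lemma card_erase_range {n i : ℕ} (hi : i < n) :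
    ((((Finset.range n).erase i).card : ℕ) : ℝ) = (n : ℝ) - 1 := by
  rw [Finset.card_erase_of_mem (Finset.mem_range.2 hi), Finset.card_range,
    Nat.cast_sub (by omega), Nat.cast_one]

lemma le_card_erase_range {n i : ℕ} (hn : N + 1 ≤ n) (hi : i < n) :
    N ≤ ((Finset.range n).erase i).card := by
  rw [Finset.card_erase_of_mem (Finset.mem_range.2 hi), Finset.card_range]
  omega

lemma integrable_ratio (h : IsRatioSample P m W Y μ v c K N) {n : ℕ} (hn : N + 1 ≤ n) {i : ℕ}
    (hi : i < n) : Integrable (fun ω => W i ω * (∑ j ∈ Finset.range n, Y j ω)⁻¹) P := by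
  simpa only [Finset.insert_erase (Finset.mem_range.2 hi)] using
    h.integrable_W_mul_inv (le_card_erase_range hn hi) (Finset.notMem_erase i _)

lemma tendsto_error (A B : ℝ) :
    Tendsto (fun n : ℕ => A / ((n : ℝ) - 1) + B / √((n : ℝ) - 1)) atTop (𝓝 0) := by
  simpa using ((tendsto_natCast_sub_atTop 1).const_div_atTop A).add
    ((Real.tendsto_sqrt_atTop.comp (tendsto_natCast_sub_atTop 1)).const_div_atTop B)

/-- First-order expansion of the mean of the ratio of the sums of `W` and `Y`. -/
theorem tendsto_mul_integral_ratio (h : IsRatioSample P m W Y μ v c K N) :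
    Tendsto (fun n : ℕ => (n : ℝ) * ∫ ω, (∑ i ∈ Finset.range n, W i ω) *
      (∑ i ∈ Finset.range n, Y i ω)⁻¹ ∂P) atTop (𝓝 (-c * (μ ^ 2)⁻¹)) := by
  obtain ⟨C, hC⟩ := h.exists_abs_integral_inv_sq_sub_le
  refine (tendsto_mul_sum_of_uniform
    (a := fun n i => ∫ ω, W i ω * (∑ j ∈ Finset.range n, Y j ω)⁻¹ ∂P)
    (tendsto_error (K * (1 + K)) (|c| * C)) ?_).congr' ?_
  · filter_upwards [eventually_ge_atTop (N + 1), eventually_ge_atTop 2] with n hn h2 i hi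
    have hq : (0 : ℝ) < n - 1 := by
      have : (2 : ℝ) ≤ n := by exact_mod_cast h2
      linarith
    have hS := le_card_erase_range hn hi
    have h1 := h.abs_integral_W_mul_inv_add_le hS (Finset.notMem_erase i _)
    have h3 := hC _ hS
    rw [Finset.insert_erase (Finset.mem_range.2 hi), card_erase_range hi] at h1
    rw [card_erase_range hi] at h3
    set E := ∫ ω, (∑ j ∈ (Finset.range n).erase i, Y j ω)⁻¹ ^ 2 ∂P
    set A := ∫ ω, W i ω * (∑ j ∈ Finset.range n, Y j ω)⁻¹ ∂P
    -- The first part is the Taylor remainder, the second the error in replacing the inverse moment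
    -- by `μ⁻²`.
    have e : ((n : ℝ) - 1) ^ 2 * A - -c * (μ ^ 2)⁻¹ =
        ((n : ℝ) - 1) ^ 2 * (A + c * E) - c * (((n : ℝ) - 1) ^ 2 * E - (μ ^ 2)⁻¹) := by ring
    rw [e]
    refine (abs_sub _ _).trans (add_le_add ?_ ?_)
    · rw [abs_mul, abs_of_pos (by positivity), le_div_iff₀ hq]
      linarith
    · rw [abs_mul, mul_div_assoc]
      exact mul_le_mul_of_nonneg_left h3 (abs_nonneg c)
  · filter_upwards [eventually_ge_atTop (N + 1)] with n hn
    simp_rw [Finset.sum_mul]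
    rw [integral_finsetSum _ fun i hi => h.integrable_ratio hn (Finset.mem_range.1 hi)]

lemma cross_term (h : IsRatioSample P m W Y μ v c K N) {n : ℕ} (hn : N + 2 ≤ n) {i j : ℕ}
    (hi : i < n) (hj : j < n) (hij : i ≠ j) :
    Integrable (fun ω => W j ω * (W i ω * (∑ k ∈ Finset.range n, Y k ω)⁻¹ ^ 2)) P ∧
    ((n : ℝ) - 2) ^ 4 *
      |∫ ω, W j ω * (W i ω * (∑ k ∈ Finset.range n, Y k ω)⁻¹ ^ 2) ∂P| ≤
        8 * (K * (K * (1 + K))) := by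
  have hi' : i ∈ (Finset.range n).erase j := by simp [hi, hij]
  have hcard : (((Finset.range n).erase j).erase i).card = n - 2 := by
    rw [Finset.card_erase_of_mem hi', Finset.card_erase_of_mem (Finset.mem_range.2 hj),
      Finset.card_range]
    omega
  have := h.abs_integral_W_mul_W_mul_inv_sq_le (S := ((Finset.range n).erase j).erase i) (i := i)
    (j := j) (by omega) (Finset.notMem_erase i _) (by simp) hij
  rwa [Finset.insert_erase hi', Finset.insert_erase (Finset.mem_range.2 hj), hcard,
    Nat.cast_sub (by omega), Nat.cast_ofNat] at this

lemma integrable_sq_term (h : IsRatioSample P m W Y μ v c K N) {n : ℕ}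
    (hn : N + 1 ≤ n) {i : ℕ} (hi : i < n) :
    Integrable (fun ω => W i ω ^ 2 * (∑ k ∈ Finset.range n, Y k ω)⁻¹ ^ 2) P := by
  simpa only [Finset.insert_erase (Finset.mem_range.2 hi)] using
    h.integrable_W_sq_mul_inv_sq (le_card_erase_range hn hi) (Finset.notMem_erase i _)

lemma ratio_sq_eq (W Y : ℕ → Ω → ℝ) (n : ℕ) (ω : Ω) :
    ((∑ i ∈ Finset.range n, W i ω) * (∑ i ∈ Finset.range n, Y i ω)⁻¹) ^ 2 =
      ∑ i ∈ Finset.range n, (W i ω ^ 2 * (∑ k ∈ Finset.range n, Y k ω)⁻¹ ^ 2 +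
        ∑ j ∈ (Finset.range n).erase i,
          W j ω * (W i ω * (∑ k ∈ Finset.range n, Y k ω)⁻¹ ^ 2)) := by
  rw [mul_pow, sq (∑ i ∈ Finset.range n, W i ω), Finset.sum_mul_sum, Finset.sum_mul]
  refine Finset.sum_congr rfl fun i hi => ?_
  rw [← Finset.add_sum_erase _ _ hi, add_mul, ← sq, Finset.sum_mul]
  congr 1
  exact Finset.sum_congr rfl fun j _ => by ring

lemma integrable_ratio_sq (h : IsRatioSample P m W Y μ v c K N) {n : ℕ} (hn : N + 2 ≤ n) :
    Integrable (fun ω => ((∑ i ∈ Finset.range n, W i ω) *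
      (∑ i ∈ Finset.range n, Y i ω)⁻¹) ^ 2) P := by
  simp_rw [ratio_sq_eq]
  refine integrable_finsetSum _ fun i hi => (h.integrable_sq_term (by omega)
    (Finset.mem_range.1 hi)).add (integrable_finsetSum _ fun j hj => ?_)
  obtain ⟨hji, hj⟩ := Finset.mem_erase.1 hj
  exact (h.cross_term hn (Finset.mem_range.1 hi) (Finset.mem_range.1 hj) hji.symm).1

lemma memLp_ratio (h : IsRatioSample P m W Y μ v c K N) {n : ℕ} (hn : N + 2 ≤ n) :
    MemLp (fun ω => (∑ i ∈ Finset.range n, W i ω) * (∑ i ∈ Finset.range n, Y i ω)⁻¹) 2 P :=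
  (memLp_two_iff_integrable_sq (h.measurable_ratio n).aestronglyMeasurable).2
    (h.integrable_ratio_sq hn)

/-- The numerator collects the normalization `(n - 1)²` and the `n - 1` partners `j` of a fixed `i`;
each cross term is `O((n - 2)⁻⁴)`. -/
lemma tendsto_cross_error (A : ℝ) :
    Tendsto (fun n : ℕ => A * (((n : ℝ) - 1) ^ 3 / ((n : ℝ) - 2) ^ 4)) atTop (𝓝 0) := by
  have h1 := (tendsto_natCast_sub_atTop 2).inv_tendsto_atTop
  have h2 := (h1.const_add 1).pow 3 |>.mul h1
  rw [mul_zero] at h2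
  rw [← mul_zero A]
  refine (h2.congr' ?_).const_mul A
  filter_upwards [eventually_ge_atTop 3] with n hn
  have : (3 : ℝ) ≤ n := by exact_mod_cast hn
  have : (n : ℝ) - 2 ≠ 0 := by linarith
  simp only [Pi.inv_apply]
  field_simp
  ring

/-- First-order expansion of the second moment of the ratio of the sums of `W` and `Y`. -/
theorem tendsto_mul_integral_ratio_sq (h : IsRatioSample P m W Y μ v c K N) :
    Tendsto (fun n : ℕ => (n : ℝ) * ∫ ω, ((∑ i ∈ Finset.range n, W i ω) *
      (∑ i ∈ Finset.range n, Y i ω)⁻¹) ^ 2 ∂P) atTop (𝓝 (v * (μ ^ 2)⁻¹)) := by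
  obtain ⟨C, hC⟩ := h.exists_abs_integral_inv_sq_sub_le
  have herr := (tendsto_error (2 * (K * (1 + K))) (|v| * C)).add
    (tendsto_cross_error (8 * (K * (K * (1 + K)))))
  rw [add_zero] at herr
  refine (tendsto_mul_sum_of_uniform
    (a := fun n i => (∫ ω, W i ω ^ 2 * (∑ j ∈ Finset.range n, Y j ω)⁻¹ ^ 2 ∂P) +
      ∑ j ∈ (Finset.range n).erase i,
        ∫ ω, W j ω * (W i ω * (∑ k ∈ Finset.range n, Y k ω)⁻¹ ^ 2) ∂P) herr ?_).congr' ?_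
  · filter_upwards [eventually_ge_atTop (N + 2), eventually_ge_atTop 3] with n hn h3' i hi
    have hn3 : (3 : ℝ) ≤ n := by exact_mod_cast h3'
    have hq : (0 : ℝ) < n - 1 := by linarith
    have hq2 : (0 : ℝ) < n - 2 := by linarith
    have hS : N ≤ ((Finset.range n).erase i).card := le_card_erase_range (by omega) hi
    have h1 := h.abs_integral_W_sq_mul_inv_sq_sub_le hS (Finset.notMem_erase i _)
    have h3 := hC _ hS
    rw [Finset.insert_erase (Finset.mem_range.2 hi), card_erase_range hi] at h1
    rw [card_erase_range hi] at h3
    set E := ∫ ω, (∑ j ∈ (Finset.range n).erase i, Y j ω)⁻¹ ^ 2 ∂P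
    set A := ∫ ω, W i ω ^ 2 * (∑ j ∈ Finset.range n, Y j ω)⁻¹ ^ 2 ∂P
    set B := ∑ j ∈ (Finset.range n).erase i,
        ∫ ω, W j ω * (W i ω * (∑ k ∈ Finset.range n, Y k ω)⁻¹ ^ 2) ∂P with hB
    have hBb : |B| ≤ ((n : ℝ) - 1) * (8 * (K * (K * (1 + K))) / ((n : ℝ) - 2) ^ 4) := by
      refine (Finset.abs_sum_le_sum_abs _ _).trans
        ((Finset.sum_le_card_nsmul _ _ (8 * (K * (K * (1 + K))) / ((n : ℝ) - 2) ^ 4)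
          fun j hj => ?_).trans ?_)
      · obtain ⟨hji, hj⟩ := Finset.mem_erase.1 hj
        rw [le_div_iff₀ (by positivity)]
        linarith [(h.cross_term hn hi (Finset.mem_range.1 hj) hji.symm).2]
      · rw [nsmul_eq_mul, card_erase_range hi]
    have e : ((n : ℝ) - 1) ^ 2 * (A + B) - v * (μ ^ 2)⁻¹ =
        ((n : ℝ) - 1) ^ 2 * (A - v * E) + v * (((n : ℝ) - 1) ^ 2 * E - (μ ^ 2)⁻¹) +
          ((n : ℝ) - 1) ^ 2 * B := by ring
    rw [e]
    refine (abs_add_le _ _).trans (add_le_add ((abs_add_le _ _).trans (add_le_add ?_ ?_)) ?_)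
    · rw [abs_mul, abs_of_pos (by positivity), le_div_iff₀ hq]
      linarith
    · rw [abs_mul, mul_div_assoc]
      exact mul_le_mul_of_nonneg_left h3 (abs_nonneg v)
    · rw [abs_mul, abs_of_pos (by positivity)]
      refine (mul_le_mul_of_nonneg_left hBb (by positivity)).trans (le_of_eq ?_)
      ring
  · filter_upwards [eventually_ge_atTop (N + 2)] with n hn
    have hc (i j : ℕ) (hi : i ∈ Finset.range n) (hj : j ∈ (Finset.range n).erase i) :=
      (h.cross_term hn (Finset.mem_range.1 hi)
        (Finset.mem_range.1 (Finset.mem_erase.1 hj).2) (Finset.mem_erase.1 hj).1.symm).1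
    have hs (i : ℕ) (hi : i ∈ Finset.range n) :=
      h.integrable_sq_term (by omega) (Finset.mem_range.1 hi)
    simp_rw [ratio_sq_eq]
    rw [integral_finsetSum _ fun i hi => by
      exact (hs i hi).add (integrable_finsetSum _ fun j hj => hc i j hi hj)]
    congr 1
    refine Finset.sum_congr rfl fun i hi => ?_
    rw [integral_add (hs i hi) (integrable_finsetSum _ fun j hj => hc i j hi hj),
      integral_finsetSum _ fun j hj => hc i j hi hj]

end IsRatioSample

/-! ### Asymptotic normality of ratios. -/

/-- Central limit theorem for the ratio of sums of i.i.d. variables with centred numerator. -/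
theorem tendstoInDistribution_ratio {Ω : Type*} [MeasurableSpace Ω] {P : Measure Ω}
    [IsProbabilityMeasure P] {W Y : ℕ → Ω → ℝ} {μ : ℝ} {v : ℝ≥0} (hμ : μ ≠ 0)
    (hW : MemLp (W 0) 2 P) (hW0 : P[W 0] = 0) (hWv : ∫ ω, W 0 ω ^ 2 ∂P = (v : ℝ)) (hWi : iIndepFun W P)
    (hWd : ∀ i, IdentDistrib (W i) (W 0) P P) (hY : Integrable (Y 0) P) (hYμ : P[Y 0] = μ)
    (hYi : iIndepFun Y P) (hYd : ∀ i, IdentDistrib (Y i) (Y 0) P P) :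
    TendstoInDistribution (fun (n : ℕ) ω => √n * ((∑ i ∈ Finset.range n, W i ω) *
      (∑ i ∈ Finset.range n, Y i ω)⁻¹)) atTop (id : ℝ → ℝ) (fun _ => P)
      (gaussianReal 0 (v * (.mk (μ ^ 2) (sq_nonneg μ))⁻¹)) := by
  have hvar : Var[W 0; P] = v := by
    rw [variance_of_integral_eq_zero hW.aemeasurable hW0]; exact hWv
  -- The limit of the numerator is realized as `μ * x` on the target Gaussian space, so that
  -- multiplication by `μ⁻¹` in Slutsky's theorem returns the identity.
  have hlaw : HasLaw (fun x : ℝ => μ * x) (gaussianReal 0 Var[W 0; P].toNNReal)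
      (gaussianReal 0 (v * (.mk (μ ^ 2) (sq_nonneg μ))⁻¹)) := by
    refine ⟨by fun_prop, ?_⟩
    rw [gaussianReal_map_const_mul, hvar, Real.toNNReal_coe, mul_zero]
    congr 1
    ext
    simp
    field_simp
  have h1 := tendstoInDistribution_inv_sqrt_mul_sum_sub hlaw hW hWi hWd
  have hae : ∀ᵐ ω ∂P, Tendsto (fun n : ℕ => ((∑ i ∈ Finset.range n, Y i ω) / n)⁻¹) atTop
      (𝓝 μ⁻¹) := by
    filter_upwards [strong_law_ae_real Y hY (fun i j hij => hYi.indepFun hij) hYd] with ω hω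
    rw [hYμ] at hω
    exact hω.inv₀ hμ
  have hm (n : ℕ) : AEMeasurable (fun ω => ((∑ i ∈ Finset.range n, Y i ω) / n)⁻¹) P :=
    ((Finset.aemeasurable_fun_sum _ fun i _ => (hYd i).aemeasurable_fst).div_const _).inv
  have h2 : TendstoInMeasure P (fun (n : ℕ) ω => ((∑ i ∈ Finset.range n, Y i ω) / n)⁻¹) atTop
      (fun _ => μ⁻¹) :=
    tendstoInMeasure_of_tendsto_ae (fun n => (hm n).aestronglyMeasurable) hae
  have h3 := h1.continuous_comp_prodMk_of_tendstoInMeasure_const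
    (g := fun p : ℝ × ℝ => p.1 * p.2) (by fun_prop) h2 hm
  refine h3.congr (fun n => ae_of_all _ fun ω => ?_) (ae_of_all _ fun x => ?_)
  · simp only [hW0, mul_zero, sub_zero, div_eq_mul_inv]
    rcases eq_or_ne n 0 with rfl | hn
    · simp
    have hs : √(n : ℝ) ≠ 0 := by positivity
    have : (n : ℝ) = √n * √n := (Real.mul_self_sqrt (by positivity)).symm
    nth_rw 2 [this]
    field_simp
  · simp only [id]
    field_simp

/-! ### Power moments of the exponential law. -/

lemma expMeasure_eq_withDensity (lam : ℝ) :
    expMeasure lam = (volume.restrict (Set.Ioi 0)).withDensity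
      fun x => ENNReal.ofReal (lam * Real.exp (-(lam * x))) := by
  rw [← withDensity_indicator measurableSet_Ioi]
  refine withDensity_congr_ae ?_
  -- The exponential density is nonzero at `0` as well, so the two densities agree only off this
  -- null point.
  have h0 : ∀ᵐ x : ℝ, x ≠ 0 := Measure.ae_ne volume 0
  filter_upwards [h0] with x hx
  have e := exponentialPDF_eq lam x
  rw [exponentialPDF, exponentialPDFReal] at e
  rw [gammaPDF, e]
  rcases lt_or_gt_of_ne hx with h | h
  · rw [Set.indicator_of_notMem (by simpa using h.le), if_neg (by simpa using h)]; simp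
  · rw [Set.indicator_of_mem (by simpa using h), if_pos h.le]

lemma ae_pos_expMeasure (lam : ℝ) : ∀ᵐ x ∂expMeasure lam, 0 < x := by
  rw [expMeasure_eq_withDensity]
  exact (withDensity_absolutelyContinuous _ _).ae_le (ae_restrict_mem measurableSet_Ioi)

lemma expMeasure_rpow {lam s : ℝ} (hlam : 0 < lam) (hs : -1 < s) :
    Integrable (fun x => x ^ s) (expMeasure lam) ∧
      ∫ x, x ^ s ∂expMeasure lam = Real.Gamma (s + 1) * lam ^ (-s) := by
  have hm : Measurable fun x => ENNReal.ofReal (lam * Real.exp (-(lam * x))) := by fun_prop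
  have ht : ∀ᵐ x ∂volume.restrict (Set.Ioi (0 : ℝ)),
      ENNReal.ofReal (lam * Real.exp (-(lam * x))) < ⊤ := ae_of_all _ fun x => ENNReal.ofReal_lt_top
  have e (x : ℝ) : (ENNReal.ofReal (lam * Real.exp (-(lam * x)))).toReal • x ^ s =
      lam * (x ^ (s + 1 - 1) * Real.exp (-(lam * x))) := by
    rw [ENNReal.toReal_ofReal (by positivity), smul_eq_mul, add_sub_cancel_right]; ring
  rw [expMeasure_eq_withDensity, integrable_withDensity_iff_integrable_smul' hm ht,
    integral_withDensity_eq_integral_toReal_smul hm ht]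
  simp_rw [e]
  constructor
  · have := integrableOn_rpow_mul_exp_neg_mul_rpow hs one_pos hlam
    simp only [Real.rpow_one, neg_mul] at this
    simp only [add_sub_cancel_right]
    exact this.const_mul lam
  · rw [integral_const_mul, Real.integral_rpow_mul_exp_neg_mul_Ioi (by linarith) hlam,
      one_div, Real.inv_rpow hlam.le, Real.rpow_add hlam, Real.rpow_one, Real.rpow_neg hlam.le]
    field_simp

/-! ### Uniform inverse moments of sums of powers. -/

variable {Ω : Type*} [MeasurableSpace Ω] {P : Measure Ω} {X : ℕ → Ω → ℝ} {lam a : ℝ}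

lemma lintegral_prod_rpow (hlam : 0 < lam) (hX : ∀ i, Measurable (X i)) (hpos : ∀ i ω, 0 < X i ω)
    (hindep : iIndepFun X P) (hlaw : ∀ i, HasLaw (X i) (expMeasure lam) P) {t : ℝ} (ht : -1 < t)
    (S : Finset ℕ) : ∫⁻ ω, ENNReal.ofReal (∏ i ∈ S, X i ω ^ t) ∂P =
      ENNReal.ofReal ((Real.Gamma (t + 1) * lam ^ (-t)) ^ S.card) := by
  have hpow : Measurable fun x : ℝ => ENNReal.ofReal (x ^ t) := by fun_prop
  have h1 := lintegral_prod_eq_prod_lintegral_of_indepFun S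
    (fun i ω => ENNReal.ofReal (X i ω ^ t)) (hindep.comp (fun _ x => ENNReal.ofReal (x ^ t))
      fun _ => hpow) fun i => hpow.comp (hX i)
  have h2 (i : ℕ) : ∫⁻ ω, ENNReal.ofReal (X i ω ^ t) ∂P =
      ENNReal.ofReal (Real.Gamma (t + 1) * lam ^ (-t)) := by
    obtain ⟨hi, he⟩ := expMeasure_rpow hlam ht
    rw [(hlaw i).lintegral_comp (f := fun x => ENNReal.ofReal (x ^ t)) hpow.aemeasurable, ← he,
      ofReal_integral_eq_lintegral_ofReal hi]
    filter_upwards [ae_pos_expMeasure lam] with x hx using Real.rpow_nonneg hx.le t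
  have hG : 0 ≤ Real.Gamma (t + 1) * lam ^ (-t) :=
    mul_nonneg (Real.Gamma_pos_of_pos (by linarith)).le (Real.rpow_nonneg hlam.le _)
  simp_rw [h2] at h1
  rw [Finset.prod_const, ← ENNReal.ofReal_pow hG] at h1
  rw [← h1]
  refine lintegral_congr fun ω => ?_
  rw [ENNReal.ofReal_prod_of_nonneg fun i _ => Real.rpow_nonneg (hpos i ω).le t]

/-- By the inequality between the arithmetic and the geometric mean. -/
lemma card_mul_inv_sum_pow_le {x : ℕ → ℝ} (hx : ∀ i, 0 < x i) (a : ℝ) {S : Finset ℕ}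
    (hS : S.Nonempty) : (S.card : ℝ) ^ 4 * (∑ i ∈ S, x i ^ a)⁻¹ ^ 4 ≤
      ∏ i ∈ S, x i ^ (-(4 * a / S.card)) := by
  have hc : (0 : ℝ) < S.card := by exact_mod_cast hS.card_pos
  have hs : 0 < ∑ i ∈ S, x i ^ a := Finset.sum_pos (fun i _ => Real.rpow_pos_of_pos (hx i) a) hS
  have amgm := Real.geom_mean_le_arith_mean_weighted S (fun _ => (S.card : ℝ)⁻¹)
    (fun i => x i ^ a) (fun _ _ => by positivity) (by simp [hc.ne'])
    fun i _ => (Real.rpow_pos_of_pos (hx i) a).le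
  rw [← Finset.mul_sum] at amgm
  have hp : 0 < ∏ i ∈ S, (x i ^ a) ^ (S.card : ℝ)⁻¹ :=
    Finset.prod_pos fun i _ => Real.rpow_pos_of_pos (Real.rpow_pos_of_pos (hx i) a) _
  have e : ∏ i ∈ S, x i ^ (-(4 * a / S.card)) =
      (∏ i ∈ S, (x i ^ a) ^ (S.card : ℝ)⁻¹)⁻¹ ^ 4 := by
    rw [← Finset.prod_inv_distrib, ← Finset.prod_pow]
    refine Finset.prod_congr rfl fun i _ => ?_
    rw [← Real.rpow_mul (hx i).le, ← Real.rpow_neg (hx i).le, ← Real.rpow_natCast,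
      ← Real.rpow_mul (hx i).le]
    congr 1
    push_cast
    ring
  rw [e, ← mul_pow]
  have : (S.card : ℝ) * (∑ i ∈ S, x i ^ a)⁻¹ = ((S.card : ℝ)⁻¹ * ∑ i ∈ S, x i ^ a)⁻¹ := by
    field_simp
  rw [this]
  gcongr

/-- Log-convexity of `Γ` with `Γ 1 = 1`: the point `1 - b/k` is the mean of `1 - b/M` and `1` with
weights `M/k` and `1 - M/k`. -/
lemma Gamma_pow_le {b M k : ℝ} (hM : 0 < M) (hb : b < M) (hk : M < k) :
    Real.Gamma (1 - b / k) ^ k ≤ Real.Gamma (1 - b / M) ^ M := by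
  have hk0 : 0 < k := hM.trans hk
  have hs : 0 < 1 - b / M := by rw [sub_pos, div_lt_one hM]; exact hb
  have h := Real.Gamma_mul_add_mul_le_rpow_Gamma_mul_rpow_Gamma hs one_pos
    (a := M / k) (b := 1 - M / k) (by positivity) (by rw [sub_pos, div_lt_one hk0]; exact hk)
    (by ring)
  simp only [Real.Gamma_one, Real.one_rpow, mul_one] at h
  have e : M / k * (1 - b / M) + (1 - M / k) = 1 - b / k := by field_simp; ring
  rw [e] at h
  have hpos : 0 < 1 - b / k := by
    rw [sub_pos, div_lt_one hk0]; linarith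
  calc _ ≤ (Real.Gamma (1 - b / M) ^ (M / k)) ^ k :=
        Real.rpow_le_rpow (Real.Gamma_pos_of_pos hpos).le h hk0.le
    _ = _ := by
        rw [← Real.rpow_mul (Real.Gamma_pos_of_pos hs).le]
        congr 1
        field_simp

lemma exists_inverse_moment_bound (hlam : 0 < lam) (ha : 0 < a) (hX : ∀ i, Measurable (X i))
    (hpos : ∀ i ω, 0 < X i ω) (hindep : iIndepFun X P)
    (hlaw : ∀ i, HasLaw (X i) (expMeasure lam) P) :
    ∃ (K : ℝ) (N : ℕ), 1 ≤ N ∧ ∀ S : Finset ℕ, N ≤ S.card →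
      Integrable (fun ω => (∑ i ∈ S, X i ω ^ a)⁻¹ ^ 4) P ∧
      (S.card : ℝ) ^ 4 * ∫ ω, (∑ i ∈ S, X i ω ^ a)⁻¹ ^ 4 ∂P ≤ K := by
  -- `M > 4a` keeps the exponent `-4a/M` above `-1`; the threshold is `M + 1` because the comparison
  -- of Gamma powers needs a size strictly above `M`.
  obtain ⟨M, hM⟩ := exists_nat_gt (4 * a)
  have hM0 : (0 : ℝ) < M := by linarith
  refine ⟨Real.Gamma (1 - 4 * a / M) ^ (M : ℝ) * lam ^ (4 * a), M + 1, by omega, fun S hS => ?_⟩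
  have hSM : (M : ℝ) < S.card := by exact_mod_cast hS
  have hc : (0 : ℝ) < S.card := hM0.trans hSM
  have hne : S.Nonempty := Finset.card_pos.1 (by omega)
  have ht : -1 < -(4 * a / S.card) := by
    rw [neg_lt_neg_iff, div_lt_one hc]; linarith
  have hlint := lintegral_prod_rpow hlam hX hpos hindep hlaw ht S
  have hm : Measurable fun ω => ∏ i ∈ S, X i ω ^ (-(4 * a / S.card)) :=
    Finset.measurable_fun_prod _ fun i _ => (hX i).pow_const _
  have hnn (ω : Ω) : 0 ≤ ∏ i ∈ S, X i ω ^ (-(4 * a / S.card)) :=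
    Finset.prod_nonneg fun i _ => Real.rpow_nonneg (hpos i ω).le _
  have hint : Integrable (fun ω => ∏ i ∈ S, X i ω ^ (-(4 * a / S.card))) P := by
    refine ⟨hm.aestronglyMeasurable, ?_⟩
    rw [hasFiniteIntegral_iff_ofReal (ae_of_all _ hnn), hlint]
    exact ENNReal.ofReal_lt_top
  have hle (ω : Ω) := card_mul_inv_sum_pow_le (fun i => hpos i ω) a hne
  have hG : 0 < Real.Gamma (-(4 * a / S.card) + 1) := Real.Gamma_pos_of_pos (by linarith)
  have hY : Measurable fun ω => (∑ i ∈ S, X i ω ^ a)⁻¹ ^ 4 :=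
    (Finset.measurable_fun_sum _ fun i _ => (hX i).pow_const a).inv.pow_const 4
  have hint4 : Integrable (fun ω => (S.card : ℝ) ^ 4 * (∑ i ∈ S, X i ω ^ a)⁻¹ ^ 4) P := by
    refine hint.mono' (hY.const_mul _).aestronglyMeasurable (ae_of_all _ fun ω => ?_)
    rw [Real.norm_of_nonneg (by positivity)]
    exact hle ω
  constructor
  · refine (hint4.const_mul ((S.card : ℝ) ^ 4)⁻¹).congr (ae_of_all _ fun ω => ?_)
    simp only
    rw [inv_mul_cancel_left₀ (by positivity)]
  · rw [← integral_const_mul]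
    refine (integral_mono hint4 hint hle).trans ?_
    rw [integral_eq_lintegral_of_nonneg_ae (ae_of_all _ hnn) hm.aestronglyMeasurable, hlint,
      ENNReal.toReal_ofReal (by positivity), mul_pow, ← Real.rpow_natCast,
      ← Real.rpow_natCast (lam ^ _), ← Real.rpow_mul hlam.le, neg_neg,
      div_mul_cancel₀ _ hc.ne', neg_add_eq_sub]
    exact mul_le_mul_of_nonneg_right (Gamma_pow_le hM0 hM hSM) (by positivity)

/-! ### Ratio samples from i.i.d. observations. -/

section Iid

variable {Ω : Type*} [MeasurableSpace Ω] {P : Measure Ω} {X : ℕ → Ω → ℝ} {ν : Measure ℝ}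

lemma integrable_comp_law {X : Ω → ℝ} (hX : HasLaw X ν P) {f : ℝ → ℝ} (hf : Integrable f ν) :
    Integrable (fun ω => f (X ω)) P := by
  rw [← hX.map_eq] at hf
  exact hf.comp_aemeasurable hX.aemeasurable

lemma integral_comp_law {X : Ω → ℝ} (hX : HasLaw X ν P) {f : ℝ → ℝ} (hf : Measurable f) :
    ∫ ω, f (X ω) ∂P = ∫ x, f x ∂ν :=
  hX.integral_comp hf.aestronglyMeasurable

lemma exists_isRatioSample_of_iid [IsProbabilityMeasure P] {w y : ℝ → ℝ} (hw : Measurable w)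
    (hy : Measurable y) (hX : ∀ i, Measurable (X i)) (hindep : iIndepFun X P)
    (hlaw : ∀ i, HasLaw (X i) ν P) (hpos : ∀ i ω, 0 < y (X i ω)) (hμ : 0 < ∫ x, y x ∂ν)
    (hw1 : Integrable w ν) (hw0 : ∫ x, w x ∂ν = 0) (hw2 : Integrable (fun x => w x ^ 2) ν)
    (hy2 : Integrable (fun x => y x ^ 2) ν) (hwy : Integrable (fun x => w x * y x) ν)
    (hwy2 : Integrable (fun x => |w x| * y x ^ 2) ν) (hw2y : Integrable (fun x => w x ^ 2 * y x) ν)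
    (hinv : ∃ (K : ℝ) (N : ℕ), 1 ≤ N ∧ ∀ S : Finset ℕ, N ≤ S.card →
      Integrable (fun ω => (∑ i ∈ S, y (X i ω))⁻¹ ^ 4) P ∧
      (S.card : ℝ) ^ 4 * ∫ ω, (∑ i ∈ S, y (X i ω))⁻¹ ^ 4 ∂P ≤ K) :
    ∃ (K : ℝ) (N : ℕ), IsRatioSample P (fun i => MeasurableSpace.comap (X i) inferInstance)
      (fun i ω => w (X i ω)) (fun i ω => y (X i ω)) (∫ x, y x ∂ν) (∫ x, w x ^ 2 ∂ν)
      (∫ x, w x * y x ∂ν) K N := by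
  obtain ⟨K₀, N, hN, hK₀⟩ := hinv
  have hmem (i : ℕ) : MemLp (fun ω => y (X i ω)) 2 P :=
    (memLp_two_iff_integrable_sq (hy.comp (hX i)).aestronglyMeasurable).2
      (integrable_comp_law (hlaw i) hy2)
  have hvar (i : ℕ) : Var[fun ω => y (X i ω); P] = Var[y; ν] := by
    rw [← (hlaw i).map_eq, variance_map hy.aemeasurable (hX i).aemeasurable]; rfl
  have n1 : 0 ≤ Var[y; ν] := variance_nonneg _ _
  have n2 : 0 ≤ ∫ x, |w x * y x| ∂ν := integral_nonneg fun x => abs_nonneg _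
  have n3 : 0 ≤ ∫ x, |w x| * y x ^ 2 ∂ν := integral_nonneg fun x => by positivity
  have n4 := abs_nonneg (∫ x, w x ^ 2 * y x ∂ν)
  have n4' := le_abs_self (∫ x, w x ^ 2 * y x ∂ν)
  have n5 := abs_nonneg K₀
  have n5' := le_abs_self K₀
  -- Adding nonnegative quantities gives one constant above every required bound; absolute values
  -- are taken where the sign is not known.
  refine ⟨Var[y; ν] + ∫ x, |w x * y x| ∂ν + ∫ x, |w x| * y x ^ 2 ∂ν +
    |∫ x, w x ^ 2 * y x ∂ν| + |K₀|, N, ?_⟩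
  exact
    { le := fun i => (hX i).comap_le
      indep := hindep.iIndep
      measurable_W := fun i => hw.comp (comap_measurable (X i))
      measurable_Y := fun i => hy.comp (comap_measurable (X i))
      pos := hpos
      mean_pos := hμ
      integrable_W := fun i => integrable_comp_law (hlaw i) hw1
      integral_W := fun i => by rw [integral_comp_law (hlaw i) hw, hw0]
      integrable_W_sq := fun i => integrable_comp_law (hlaw i) hw2
      integral_W_sq := fun i => integral_comp_law (hlaw i) (f := fun x => w x ^ 2) (by fun_prop)
      memLp_Y := hmem
      integral_Y := fun i => integral_comp_law (hlaw i) hy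
      variance_Y := fun i => by rw [hvar]; linarith
      integrable_W_mul_Y := fun i => integrable_comp_law (hlaw i) hwy
      integral_W_mul_Y := fun i =>
        integral_comp_law (hlaw i) (f := fun x => w x * y x) (by fun_prop)
      integral_abs_W_mul_Y := fun i => by
        rw [integral_comp_law (hlaw i) (f := fun x => |w x * y x|) (by fun_prop)]; linarith
      integrable_W_mul_Y_sq := fun i => integrable_comp_law (hlaw i) hwy2
      integral_W_mul_Y_sq := fun i => by
        rw [integral_comp_law (hlaw i) (f := fun x => |w x| * y x ^ 2) (by fun_prop)]; linarith
      integrable_W_sq_mul_Y := fun i => integrable_comp_law (hlaw i) hw2y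
      integral_W_sq_mul_Y := fun i => by
        rw [integral_comp_law (hlaw i) (f := fun x => w x ^ 2 * y x) (by fun_prop)]; linarith
      one_le := hN
      integrable_inv := fun S hS => (hK₀ S hS).1
      integral_inv := fun S hS => (hK₀ S hS).2.trans (by linarith) }

end Iid

/-! ### Moments of the score and the generalized binomial coefficients. -/

section Moments

variable {lam a : ℝ}

/-- Three-term combinations of powers, under the exponential law. -/
lemma expMeasure_rpow_combination (hlam : 0 < lam) {f : ℝ → ℝ} {c₁ c₂ c₃ s₁ s₂ s₃ : ℝ}
    (h₁ : -1 < s₁) (h₂ : -1 < s₂) (h₃ : -1 < s₃)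
    (hf : ∀ x, 0 < x → f x = c₁ * x ^ s₁ + c₂ * x ^ s₂ + c₃ * x ^ s₃) :
    Integrable f (expMeasure lam) ∧ ∫ x, f x ∂expMeasure lam =
      c₁ * (Real.Gamma (s₁ + 1) * lam ^ (-s₁)) + c₂ * (Real.Gamma (s₂ + 1) * lam ^ (-s₂)) +
        c₃ * (Real.Gamma (s₃ + 1) * lam ^ (-s₃)) := by
  obtain ⟨i₁, e₁⟩ := expMeasure_rpow hlam h₁
  obtain ⟨i₂, e₂⟩ := expMeasure_rpow hlam h₂
  obtain ⟨i₃, e₃⟩ := expMeasure_rpow hlam h₃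
  have hae : f =ᵐ[expMeasure lam] fun x => c₁ * x ^ s₁ + c₂ * x ^ s₂ + c₃ * x ^ s₃ := by
    filter_upwards [ae_pos_expMeasure lam] with x hx using hf x hx
  have i₁₂ : Integrable (fun x => c₁ * x ^ s₁ + c₂ * x ^ s₂) (expMeasure lam) :=
    (i₁.const_mul c₁).add (i₂.const_mul c₂)
  refine ⟨(i₁₂.add (i₃.const_mul c₃)).congr hae.symm, ?_⟩
  rw [integral_congr_ae hae, integral_add i₁₂ (i₃.const_mul c₃),
    integral_add (i₁.const_mul c₁) (i₂.const_mul c₂), integral_const_mul, integral_const_mul,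
    integral_const_mul, e₁, e₂, e₃]

/-- The summand of the numerator of `steinEstimator - lam` for the weight function `x ^ a`. -/
noncomputable def score (lam a x : ℝ) : ℝ := a * x ^ (a - 1) - lam * x ^ a

lemma measurable_score : Measurable (score lam a) := by
  unfold score; fun_prop

lemma integral_rpow_expMeasure (hlam : 0 < lam) (ha : 1 / 2 < a) :
    ∫ x, x ^ a ∂expMeasure lam = Real.Gamma (a + 1) * lam ^ (-a) :=
  (expMeasure_rpow hlam (by linarith)).2

/-- Stein's identity `E f'(X) = lam * E f(X)`, which for powers is `Γ(a + 1) = a Γ(a)`. -/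
lemma score_moment (hlam : 0 < lam) (ha : 1 / 2 < a) :
    Integrable (score lam a) (expMeasure lam) ∧ ∫ x, score lam a x ∂expMeasure lam = 0 := by
  obtain ⟨h1, h2⟩ := expMeasure_rpow_combination hlam (f := score lam a) (c₁ := a) (c₂ := -lam)
    (c₃ := 0) (s₁ := a - 1) (s₂ := a) (s₃ := 0) (by linarith) (by linarith) (by linarith)
    fun x _ => by unfold score; ring
  refine ⟨h1, h2.trans ?_⟩
  rw [sub_add_cancel, Real.Gamma_add_one (by linarith), neg_sub, sub_eq_add_neg,
    Real.rpow_add hlam, Real.rpow_one]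
  ring

lemma score_sq_eq {x : ℝ} (hx : 0 < x) : score lam a x ^ 2 =
    a ^ 2 * x ^ (2 * a - 2) + (-2 * a * lam) * x ^ (2 * a - 1) + lam ^ 2 * x ^ (2 * a) := by
  have e1 : x ^ (2 * a - 2) = x ^ (a - 1) * x ^ (a - 1) := by
    rw [← Real.rpow_add hx]; congr 1; ring
  have e2 : x ^ (2 * a - 1) = x ^ (a - 1) * x ^ a := by
    rw [← Real.rpow_add hx]; congr 1; ring
  have e3 : x ^ (2 * a) = x ^ a * x ^ a := by
    rw [← Real.rpow_add hx]; congr 1; ring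
  rw [e1, e2, e3, score]
  ring

/-- The condition `a > 1/2` is exactly integrability of `x ^ (2a - 2)` at the origin. The recurrence
of `Γ` makes the other two terms cancel up to the stated multiple. -/
lemma score_sq_moment (hlam : 0 < lam) (ha : 1 / 2 < a) :
    Integrable (fun x => score lam a x ^ 2) (expMeasure lam) ∧
      ∫ x, score lam a x ^ 2 ∂expMeasure lam =
        a ^ 2 * Real.Gamma (2 * a - 1) * lam ^ (2 - 2 * a) := by
  obtain ⟨h1, h2⟩ := expMeasure_rpow_combination hlam (f := fun x => score lam a x ^ 2)
    (c₁ := a ^ 2) (c₂ := -2 * a * lam) (c₃ := lam ^ 2) (s₁ := 2 * a - 2) (s₂ := 2 * a - 1)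
    (s₃ := 2 * a) (by linarith) (by linarith) (by linarith) fun x hx => score_sq_eq hx
  refine ⟨h1, h2.trans ?_⟩
  have g1 : Real.Gamma (2 * a - 1 + 1) = (2 * a - 1) * Real.Gamma (2 * a - 1) :=
    Real.Gamma_add_one (by linarith)
  have g2 : Real.Gamma (2 * a + 1) = 2 * a * ((2 * a - 1) * Real.Gamma (2 * a - 1)) := by
    rw [Real.Gamma_add_one (by linarith), ← g1, sub_add_cancel]
  have g0 : 2 * a - 2 + 1 = 2 * a - 1 := by ring
  have l1 : lam ^ (-(2 * a - 2)) = lam ^ 2 * lam ^ (-(2 * a)) := by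
    rw [← Real.rpow_natCast, ← Real.rpow_add hlam]; congr 1; push_cast; ring
  have l2 : lam ^ (-(2 * a - 1)) = lam * lam ^ (-(2 * a)) := by
    rw [← Real.rpow_one_add' hlam.le (by linarith)]; congr 1; ring
  have l3 : lam ^ (2 - 2 * a) = lam ^ 2 * lam ^ (-(2 * a)) := by rw [← l1, neg_sub]
  rw [g0, g1, g2, l1, l2, l3]
  ring

lemma score_mul_rpow_moment (hlam : 0 < lam) (ha : 1 / 2 < a) :
    Integrable (fun x => score lam a x * x ^ a) (expMeasure lam) ∧
      ∫ x, score lam a x * x ^ a ∂expMeasure lam =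
        -(lam / 2 * (Real.Gamma (2 * a + 1) * lam ^ (-(2 * a)))) := by
  obtain ⟨h1, h2⟩ := expMeasure_rpow_combination hlam (f := fun x => score lam a x * x ^ a)
    (c₁ := a) (c₂ := -lam) (c₃ := 0) (s₁ := 2 * a - 1) (s₂ := 2 * a) (s₃ := 0)
    (by linarith) (by linarith) (by linarith) fun x hx => by
      have e2 : x ^ (2 * a - 1) = x ^ (a - 1) * x ^ a := by
        rw [← Real.rpow_add hx]; congr 1; ring
      have e3 : x ^ (2 * a) = x ^ a * x ^ a := by
        rw [← Real.rpow_add hx]; congr 1; ring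
      rw [e2, e3, score]; ring
  refine ⟨h1, h2.trans ?_⟩
  have l2 : lam ^ (-(2 * a - 1)) = lam * lam ^ (-(2 * a)) := by
    rw [← Real.rpow_one_add' hlam.le (by linarith)]; congr 1; ring
  rw [sub_add_cancel, Real.Gamma_add_one (by linarith : 2 * a ≠ 0), l2]
  ring

lemma integrable_rpow_sq (hlam : 0 < lam) (ha : 1 / 2 < a) :
    Integrable (fun x : ℝ => (x ^ a) ^ 2) (expMeasure lam) := by
  refine (expMeasure_rpow hlam (s := 2 * a) (by linarith)).1.congr ?_
  filter_upwards [ae_pos_expMeasure lam] with x hx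
  rw [sq, ← Real.rpow_add hx]; congr 1; ring

lemma integrable_abs_score_mul_rpow_sq (hlam : 0 < lam) (ha : 1 / 2 < a) :
    Integrable (fun x : ℝ => |score lam a x| * (x ^ a) ^ 2) (expMeasure lam) := by
  have h := (expMeasure_rpow_combination hlam (f := fun x => score lam a x * (x ^ a) ^ 2)
    (c₁ := a) (c₂ := -lam) (c₃ := 0) (s₁ := 3 * a - 1) (s₂ := 3 * a) (s₃ := 0)
    (by linarith) (by linarith) (by linarith) fun x hx => by
      have e2 : x ^ (3 * a - 1) = x ^ (a - 1) * (x ^ a * x ^ a) := by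
        rw [← Real.rpow_add hx, ← Real.rpow_add hx]; congr 1; ring
      have e3 : x ^ (3 * a) = x ^ a * (x ^ a * x ^ a) := by
        rw [← Real.rpow_add hx, ← Real.rpow_add hx]; congr 1; ring
      rw [e2, e3, score]; ring).1
  simpa [abs_mul] using h.abs

lemma integrable_score_sq_mul_rpow (hlam : 0 < lam) (ha : 1 / 2 < a) :
    Integrable (fun x : ℝ => score lam a x ^ 2 * x ^ a) (expMeasure lam) :=
  (expMeasure_rpow_combination hlam
    (c₁ := a ^ 2) (c₂ := -2 * a * lam) (c₃ := lam ^ 2) (s₁ := 3 * a - 2) (s₂ := 3 * a - 1)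
    (s₃ := 3 * a) (by linarith) (by linarith) (by linarith) fun x hx => by
      have e1 : x ^ (3 * a - 2) = x ^ (2 * a - 2) * x ^ a := by
        rw [← Real.rpow_add hx]; congr 1; ring
      have e2 : x ^ (3 * a - 1) = x ^ (2 * a - 1) * x ^ a := by
        rw [← Real.rpow_add hx]; congr 1; ring
      have e3 : x ^ (3 * a) = x ^ (2 * a) * x ^ a := by
        rw [← Real.rpow_add hx]; congr 1; ring
      rw [score_sq_eq hx, e1, e2, e3]; ring).1

lemma genBinom_variance (hlam : 0 < lam) (ha : 1 / 2 < a) :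
    a ^ 2 * Real.Gamma (2 * a - 1) * lam ^ (2 - 2 * a) *
      ((Real.Gamma (a + 1) * lam ^ (-a)) ^ 2)⁻¹ =
        lam ^ 2 * genBinom (2 * (a - 1)) (a - 1) := by
  have h1 : 2 * (a - 1) + 1 = 2 * a - 1 := by ring
  have h2 : 2 * (a - 1) - (a - 1) + 1 = a := by ring
  have l : lam ^ (2 - 2 * a) = lam ^ 2 * (lam ^ (-a)) ^ 2 := by
    rw [← Real.rpow_natCast, ← Real.rpow_natCast, ← Real.rpow_mul hlam.le, ← Real.rpow_add hlam]
    congr 1; push_cast; ring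
  have hG : Real.Gamma a ≠ 0 := (Real.Gamma_pos_of_pos (by linarith)).ne'
  have hl : lam ^ (-a) ≠ 0 := (Real.rpow_pos_of_pos hlam _).ne'
  have ha0 : a ≠ 0 := by linarith
  rw [genBinom, h1, h2, sub_add_cancel, l, Real.Gamma_add_one ha0]
  field_simp

lemma genBinom_bias (hlam : 0 < lam) (ha : 1 / 2 < a) :
    lam / 2 * (Real.Gamma (2 * a + 1) * lam ^ (-(2 * a))) *
      ((Real.Gamma (a + 1) * lam ^ (-a)) ^ 2)⁻¹ = lam / 2 * genBinom (2 * a) a := by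
  have h2 : 2 * a - a + 1 = a + 1 := by ring
  have l : lam ^ (-(2 * a)) = (lam ^ (-a)) ^ 2 := by
    rw [← Real.rpow_natCast, ← Real.rpow_mul hlam.le]
    congr 1; push_cast; ring
  have hG : Real.Gamma (a + 1) ≠ 0 := (Real.Gamma_pos_of_pos (by linarith)).ne'
  have hl : lam ^ (-a) ≠ 0 := (Real.rpow_pos_of_pos hlam _).ne'
  rw [genBinom, h2, l]
  field_simp

end Moments

/-! ### From the estimator to the ratio. -/

section Estimator

variable {Ω : Type*} {lam a : ℝ}

lemma steinEstimator_sub_eq {x : ℕ → Ω → ℝ} {ω : Ω} (hx : ∀ i, 0 < x i ω) {n : ℕ} (hn : 1 ≤ n) :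
    steinEstimator (fun x : ℝ => x ^ a) x n ω - lam =
      (∑ i ∈ Finset.range n, score lam a (x i ω)) * (∑ i ∈ Finset.range n, x i ω ^ a)⁻¹ := by
  have hs : 0 < ∑ i ∈ Finset.range n, x i ω ^ a :=
    Finset.sum_pos (fun i _ => Real.rpow_pos_of_pos (hx i) a) ⟨0, Finset.mem_range.2 hn⟩
  have hn0 : (n : ℝ) ≠ 0 := by positivity
  have hd : ∑ i ∈ Finset.range n, deriv (fun x : ℝ => x ^ a) (x i ω) =
      ∑ i ∈ Finset.range n, a * x i ω ^ (a - 1) :=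
    Finset.sum_congr rfl fun i _ => Real.deriv_rpow_const _ _
  simp only [steinEstimator, sampleMoment, score, hd, Finset.sum_sub_distrib, ← Finset.mul_sum]
  field_simp

variable [MeasurableSpace Ω] {P : Measure Ω} {X : ℕ → Ω → ℝ}

/-- The law yields only almost everywhere measurability and positivity, while the ratio argument
uses both everywhere; the value `1` on the null set is arbitrary. -/
lemma exists_measurable_pos_modification (hlaw : ∀ i, HasLaw (X i) (expMeasure lam) P) :
    ∃ Z : ℕ → Ω → ℝ, (∀ i, Measurable (Z i)) ∧ (∀ i ω, 0 < Z i ω) ∧ ∀ i, X i =ᵐ[P] Z i := by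
  refine ⟨fun i ω => if 0 < (hlaw i).aemeasurable.mk (X i) ω then
    (hlaw i).aemeasurable.mk (X i) ω else 1, fun i => ?_, fun i ω => ?_, fun i => ?_⟩
  · have h := (hlaw i).aemeasurable.measurable_mk
    exact Measurable.ite (measurableSet_lt measurable_const h) h measurable_const
  · dsimp only
    split_ifs with h
    · exact h
    · exact one_pos
  · have hpos : ∀ᵐ ω ∂P, 0 < X i ω :=
      ((hlaw i).ae_iff (p := fun x => 0 < x) (by measurability)).2 (ae_pos_expMeasure lam)
    filter_upwards [hpos, (hlaw i).aemeasurable.ae_eq_mk] with ω h1 h2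
    rw [← h2, if_pos h1]

lemma isLittleO_one_div_of_tendsto {u : ℕ → ℝ} {β : ℝ}
    (h : Tendsto (fun n : ℕ => (n : ℝ) * u n) atTop (𝓝 β)) :
    (fun n : ℕ => u n - β / n) =o[atTop] fun n : ℕ => 1 / (n : ℝ) := by
  rw [isLittleO_iff_tendsto' (by
    filter_upwards [eventually_ge_atTop 1] with n hn h0
    have : (n : ℝ) ≠ 0 := by positivity
    simp [this] at h0)]
  have h1 := h.sub_const β
  rw [sub_self] at h1
  refine h1.congr' ?_
  filter_upwards [eventually_ge_atTop 1] with n hn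
  have : (n : ℝ) ≠ 0 := by positivity
  field_simp

end Estimator

end SteinMM

/-! ### Assembly. -/

theorem mainTheorem10 {Ω : Type*} [MeasurableSpace Ω] (P : Measure Ω) [IsProbabilityMeasure P]
    (X : ℕ → Ω → ℝ) (lam a : ℝ) (hlam : 0 < lam) (ha : 1 / 2 < a)
    (hindep : iIndepFun X P) (hlaw : ∀ i, HasLaw (X i) (expMeasure lam) P) :
    SteinMM.IsAsymptoticallyNormal (SteinMM.steinEstimator (fun x : ℝ => x ^ a) X) lam P
      (fun n => lam ^ 2 / n * SteinMM.genBinom (2 * (a - 1)) (a - 1)) ∧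
    SteinMM.HasAsymptoticBias (SteinMM.steinEstimator (fun x : ℝ => x ^ a) X) lam P
      (fun n => lam / (2 * n) * SteinMM.genBinom (2 * a) a) ∧
    SteinMM.HasAsymptoticMSE (SteinMM.steinEstimator (fun x : ℝ => x ^ a) X) lam P
      (fun n => lam ^ 2 * (1 / n * SteinMM.genBinom (2 * (a - 1)) (a - 1) +
        1 / (4 * n ^ 2) * SteinMM.genBinom (2 * a) a ^ 2)) ∧
    (∀ᶠ n in atTop, MemLp (SteinMM.steinEstimator (fun x : ℝ => x ^ a) X n) 2 P) ∧
    (fun n : ℕ =>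
      (∫ ω, (SteinMM.steinEstimator (fun x : ℝ => x ^ a) X n ω - lam) ^ 2 ∂P) -
        lam ^ 2 * (1 / n * SteinMM.genBinom (2 * (a - 1)) (a - 1) +
          1 / (4 * n ^ 2) * SteinMM.genBinom (2 * a) a ^ 2))
      =o[atTop] (fun n : ℕ => 1 / (n : ℝ)) := by
  obtain ⟨Z, hZm, hZpos, hXZ⟩ := SteinMM.exists_measurable_pos_modification hlaw
  have hZi : iIndepFun Z P := hindep.congr hXZ
  have hZl (i : ℕ) : HasLaw (Z i) (expMeasure lam) P := (hlaw i).congr (hXZ i).symm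
  have hZd (i : ℕ) : IdentDistrib (Z i) (Z 0) P P :=
    ⟨(hZm i).aemeasurable, (hZm 0).aemeasurable, by rw [(hZl i).map_eq, (hZl 0).map_eq]⟩
  set T := SteinMM.steinEstimator (fun x : ℝ => x ^ a) X with hT
  set D : ℕ → Ω → ℝ := fun n ω => (∑ i ∈ Finset.range n, SteinMM.score lam a (Z i ω)) *
    (∑ i ∈ Finset.range n, Z i ω ^ a)⁻¹ with hD
  have hTD (n : ℕ) (hn : 1 ≤ n) : ∀ᵐ ω ∂P, T n ω - lam = D n ω := by
    filter_upwards [ae_all_iff.2 hXZ] with ω hω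
    simp only [hD]
    rw [← SteinMM.steinEstimator_sub_eq (fun i => hZpos i ω) hn]
    simp only [hT, SteinMM.steinEstimator, SteinMM.sampleMoment, hω]
  obtain ⟨iw, w0⟩ := SteinMM.score_moment hlam ha
  obtain ⟨iw2, w2⟩ := SteinMM.score_sq_moment hlam ha
  obtain ⟨iwy, wy⟩ := SteinMM.score_mul_rpow_moment hlam ha
  have hμ := SteinMM.integral_rpow_expMeasure hlam ha
  have hy : Measurable fun x : ℝ => x ^ a := by fun_prop
  have hμpos : 0 < ∫ x, x ^ a ∂expMeasure lam := by
    rw [hμ]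
    exact mul_pos (Real.Gamma_pos_of_pos (by linarith)) (Real.rpow_pos_of_pos hlam _)
  obtain ⟨K, N, hS⟩ := SteinMM.exists_isRatioSample_of_iid SteinMM.measurable_score hy hZm hZi hZl
    (fun i ω => Real.rpow_pos_of_pos (hZpos i ω) a) hμpos iw w0 iw2
    (SteinMM.integrable_rpow_sq hlam ha) iwy (SteinMM.integrable_abs_score_mul_rpow_sq hlam ha)
    (SteinMM.integrable_score_sq_mul_rpow hlam ha)
    (SteinMM.exists_inverse_moment_bound hlam (by linarith) hZm hZpos hZi hZl)
  have hbias := hS.tendsto_mul_integral_ratio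
  have hmse := hS.tendsto_mul_integral_ratio_sq
  rw [wy, neg_neg, hμ, SteinMM.genBinom_bias hlam ha] at hbias
  rw [w2, hμ, SteinMM.genBinom_variance hlam ha] at hmse
  obtain ⟨v, hv⟩ : ∃ v : ℝ≥0, (v : ℝ) = ∫ x, SteinMM.score lam a x ^ 2 ∂expMeasure lam :=
    ⟨.mk _ (integral_nonneg fun x => sq_nonneg _), rfl⟩
  have hnormal : SteinMM.IsAsymptoticallyNormal T lam P
      (fun n => lam ^ 2 / n * SteinMM.genBinom (2 * (a - 1)) (a - 1)) := by
    have hclt := SteinMM.tendstoInDistribution_ratio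
      (W := fun i ω => SteinMM.score lam a (Z i ω)) (Y := fun i ω => Z i ω ^ a)
      (v := v) hμpos.ne'
      ((memLp_two_iff_integrable_sq (hS.measurable_W' 0).aestronglyMeasurable).2
        (hS.integrable_W_sq 0)) (hS.integral_W 0) ((hS.integral_W_sq 0).trans hv.symm)
      (hZi.comp (fun _ => SteinMM.score lam a) fun _ => SteinMM.measurable_score)
      (fun i => (hZd i).comp SteinMM.measurable_score)
      ((hS.memLp_Y 0).integrable (by norm_num)) (hS.integral_Y 0)
      (hZi.comp (fun _ x => x ^ a) fun _ => hy) (fun i => (hZd i).comp hy)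
    refine ⟨_, hclt.congr (fun n => ?_) EventuallyEq.rfl, fun n _ => ?_⟩
    · rcases Nat.eq_zero_or_pos n with rfl | hn
      · exact ae_of_all _ fun ω => by simp
      · filter_upwards [hTD n hn] with ω hω
        rw [hω]
    · simp only [NNReal.coe_mul, NNReal.coe_inv, NNReal.coe_mk]
      rw [hv, w2, hμ, SteinMM.genBinom_variance hlam ha]
      ring
  have hmemD : ∀ᶠ n in atTop, MemLp (D n) 2 P := by
    filter_upwards [eventually_ge_atTop (N + 2)] with n hn using hS.memLp_ratio hn
  have hmem : ∀ᶠ n in atTop, MemLp (T n) 2 P := by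
    filter_upwards [hmemD, eventually_ge_atTop 1] with n hD hn
    refine (hD.add (memLp_const lam)).ae_eq ?_
    filter_upwards [hTD n hn] with ω hω
    simp only [Pi.add_apply, ← hω, sub_add_cancel]
  have hint : ∀ᶠ n in atTop, Integrable (T n) P := hmem.mono fun n h => h.integrable (by norm_num)
  have hbiasT : SteinMM.HasAsymptoticBias T lam P
      (fun n => lam / (2 * n) * SteinMM.genBinom (2 * a) a) := by
    have hb (n : ℕ) : lam / (2 * n) * SteinMM.genBinom (2 * a) a =
        lam / 2 * SteinMM.genBinom (2 * a) a / n := by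
      rw [← div_div]; ring
    refine ⟨⟨lam / 2 * SteinMM.genBinom (2 * a) a, fun n _ => hb n⟩, hint, ?_⟩
    simp_rw [hb]
    refine SteinMM.isLittleO_one_div_of_tendsto (hbias.congr' ?_)
    filter_upwards [hint, eventually_ge_atTop 1] with n hi hn
    have : ∫ ω, T n ω - lam ∂P = (∫ ω, T n ω ∂P) - lam := by
      rw [integral_sub hi (integrable_const _)]; simp
    rw [← this, integral_congr_ae (hTD n hn)]
  refine ⟨hnormal, hbiasT, ⟨_, _, hnormal, hbiasT, fun n hn => ?_⟩, hmem, ?_⟩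
  · have : (n : ℝ) ≠ 0 := by positivity
    field_simp
    ring
  · have h1 : (fun n : ℕ => (∫ ω, (T n ω - lam) ^ 2 ∂P) -
        lam ^ 2 * SteinMM.genBinom (2 * (a - 1)) (a - 1) / n) =o[atTop]
          fun n : ℕ => 1 / (n : ℝ) := by
      refine SteinMM.isLittleO_one_div_of_tendsto (hmse.congr' ?_)
      filter_upwards [eventually_ge_atTop 1] with n hn
      congr 1
      refine integral_congr_ae ?_
      filter_upwards [hTD n hn] with ω hω
      rw [hω]
    -- The squared bias is `O(1/n²)`, so its `1/n` coefficient is `0` and it may be subtracted at no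
    -- cost.
    have h2 : (fun n : ℕ => lam ^ 2 * SteinMM.genBinom (2 * a) a ^ 2 / 4 / n / n - 0 / n)
        =o[atTop] fun n : ℕ => 1 / (n : ℝ) := by
      refine SteinMM.isLittleO_one_div_of_tendsto
        (u := fun n : ℕ => lam ^ 2 * SteinMM.genBinom (2 * a) a ^ 2 / 4 / n / n)
        ((tendsto_const_div_atTop_nhds_zero_nat
        (lam ^ 2 * SteinMM.genBinom (2 * a) a ^ 2 / 4)).congr' ?_)
      filter_upwards [eventually_ge_atTop 1] with n hn
      have : (n : ℝ) ≠ 0 := by positivity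
      field_simp
    refine (h1.sub h2).congr_left fun n => ?_
    rcases Nat.eq_zero_or_pos n with rfl | hn
    · simp
    · have : (n : ℝ) ≠ 0 := by positivity
      field_simp
      ring
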